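/- Let $n\ge 0$ and let $\mathbb{P}^n=\mathbb{P}(\mathbb{C}[z_0,\dots,z_n]_1)$ be the projective space of linear forms up to a nonzero scalar. Put $r=\binom{n+4}{4}-1$ and $\mathbb{P}^r=\mathbb{P}(\mathbb{C}[z_0,\dots,z_n]_4)$. Let $\nu_4:\mathbb{P}^n\to\mathbb{P}^r$, $[\ell]\mapsto[\ell^4]$, be the Veronese embedding, and put $X=\nu_4(\mathbb{P}^n)$. Write $\langle\ \rangle$ for the linear span, with $\dim\emptyset=-1$. The rank of $q\in\mathbb{P}^r$ is the least cardinality of a finite set $B\subset X$ with $q\in\langle B\rangle$. Let $\mathcal{S}(X,q)$ be the set of all finite $B\subset X$ with $q\in\langle B\rangle$ and $|B|$ equal to the rank of $q$. The point $q$ is called identifiable if $|\mathcal{S}(X,q)|=1$. A finite set $A\subset\mathbb{P}^n$ is in linearly general position (LGP) if $\dim\langle B\rangle=\min\{n,|B|-1\}$ for every $B\subseteq A$. Theorem. Let $S\subset\mathbb{P}^n$ be a finite set with $|S|=2n+1$, and let $q\in\mathbb{P}^r$ be such that $\nu_4(S)$ minimally spans $q$, i.e. $q\in\langle\nu_4(S)\rangle$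 and $q\notin\langle E\rangle$ for every $E\subsetneq\nu_4(S)$. Assume that there is $S'\subset S$ with $|S'|=2n$ such that $S'$ is in LGP, but no $S''$ with $S'\subsetneq S''\subseteq S$ is in LGP. Let $e$ be the least dimension of a linear subspace $N\subseteq\mathbb{P}^n$ such that $|N\cap S|\ge \dim N+2$. Then: 1. $q$ has rank $2n+1$; 2. $q$ is identifiable if and only if $e\ge 2$; 3. if $e=1$, then $\dim\mathcal{S}(X,q)=1$. Here $X$ is identified with $\mathbb{P}^n$ by $\nu_4$, and a set of $k$ points $\{[\ell_1],\dots,[\ell_k]\}$ of $\mathbb{P}^n$ is identified with the point $[\ell_1\cdots\ell_k]$ of $\mathbb{P}(\mathbb{C}[z_0,\dots,z_n]_k)$, where $k=2n+1$ is the rank of $q$. The dimension of $\mathcal{S}(X,q)$ is the Krull dimension of the corresponding subset of this projective space, with the topology induced by the Zariski topology. -/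

import Mathlib

open scoped LinearAlgebra.Projectivization

namespace Waring

noncomputable section

/-! ### Linear subspaces of a projective space -/

section Projective

variable {V : Type*} [AddCommGroup V] [Module ℂ V]

/-- The dimension of a linear subspace of a (finite dimensional) projective space, with the
convention `dim ∅ = -1`. -/
def projDim (W : Projectivization.Subspace ℂ V) : ℤ :=
  (Module.finrank ℂ (Projectivization.Subspace.submodule W) : ℤ) - 1

/-- The linear span of a set of points. -/
abbrev linSpan (A : Set (ℙ ℂ V)) : Projectivization.Subspace ℂ V :=
  Projectivization.Subspace.span A

/-- `E` minimally spans `q`: `q` is in the span of `E` but not in the span of any proper subset. -/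
def MinimallySpans (E : Set (ℙ ℂ V)) (q : ℙ ℂ V) : Prop :=
  q ∈ linSpan E ∧ ∀ E' : Set (ℙ ℂ V), E' ⊂ E → q ∉ linSpan E'

/-- The `X`-rank of `q`: the minimal cardinality of a finite subset of `X` whose span contains `q`. -/
def xRank (X : Set (ℙ ℂ V)) (q : ℙ ℂ V) : ℕ :=
  sInf {k : ℕ | ∃ B : Finset (ℙ ℂ V), (B : Set (ℙ ℂ V)) ⊆ X ∧ q ∈ linSpan (B : Set (ℙ ℂ V)) ∧
    B.card = k}

/-- The set of all finite subsets of `X` evincing the `X`-rank of `q`. -/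
def evincing (X : Set (ℙ ℂ V)) (q : ℙ ℂ V) : Set (Finset (ℙ ℂ V)) :=
  {B | (B : Set (ℙ ℂ V)) ⊆ X ∧ q ∈ linSpan (B : Set (ℙ ℂ V)) ∧ B.card = xRank X q}

/-- `q` is identifiable with respect to `X`: exactly one subset of `X` evinces its rank. -/
def Identifiable (X : Set (ℙ ℂ V)) (q : ℙ ℂ V) : Prop :=
  ∃! B : Finset (ℙ ℂ V), B ∈ evincing X q

/-! ### The Zariski topology of a projective space

Polynomial functions on `V` are polynomials in linear functionals on `V`. -/

/-- The value at `v` of a polynomial in linear functionals. -/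
def evalAt (F : MvPolynomial (Module.Dual ℂ V) ℂ) (v : V) : ℂ :=
  MvPolynomial.eval (fun φ : Module.Dual ℂ V => φ v) F

/-- The common zeros in `ℙ(V)` of a family of homogeneous polynomials. -/
def zeroLocus (I : Set (MvPolynomial (Module.Dual ℂ V) ℂ)) : Set (ℙ ℂ V) :=
  {p | ∀ F ∈ I, evalAt F p.rep = 0}

/-- The closed sets of the Zariski topology. -/
def IsAlgebraicSet (Z : Set (ℙ ℂ V)) : Prop :=
  ∃ I : Set (MvPolynomial (Module.Dual ℂ V) ℂ),
    (∀ F ∈ I, ∃ m : ℕ, F.IsHomogeneous m) ∧ Z = zeroLocus I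

/-- The Zariski topology on `ℙ(V)`. -/
@[reducible]
def zariskiTopology (V : Type*) [AddCommGroup V] [Module ℂ V] : TopologicalSpace (ℙ ℂ V) :=
  TopologicalSpace.ofClosed {Z : Set (ℙ ℂ V) | IsAlgebraicSet Z}
    (by
      refine ⟨{1}, ?_, ?_⟩
      · rintro F rfl
        exact ⟨0, MvPolynomial.isHomogeneous_one _ _⟩
      · ext p
        simp [zeroLocus, evalAt])
    (by
      intro A hA
      have hA' : ∀ Z ∈ A, IsAlgebraicSet Z := fun Z hZ => hA hZ
      choose! I hI hZ using hA'
      refine ⟨⋃ Z ∈ A, I Z, ?_, ?_⟩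
      · intro F hF
        simp only [Set.mem_iUnion] at hF
        obtain ⟨Z, hZA, hFZ⟩ := hF
        exact hI Z hZA F hFZ
      · ext p
        simp only [Set.mem_sInter, zeroLocus, Set.mem_ofPred_eq, Set.mem_iUnion]
        constructor
        · rintro h F ⟨Z, hZA, hFZ⟩
          have h1 := h Z hZA
          rw [hZ Z hZA] at h1
          exact h1 F hFZ
        · intro h Z hZA
          rw [hZ Z hZA]
          exact fun F hF => h F ⟨Z, hZA, hF⟩)
    (by
      rintro _ ⟨I, hI, rfl⟩ _ ⟨J, hJ, rfl⟩
      refine ⟨{H | ∃ F ∈ I, ∃ G ∈ J, H = F * G}, ?_, ?_⟩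
      · rintro _ ⟨F, hF, G, hG, rfl⟩
        obtain ⟨a, ha⟩ := hI F hF
        obtain ⟨b, hb⟩ := hJ G hG
        exact ⟨a + b, ha.mul hb⟩
      · ext p
        simp only [Set.mem_union, zeroLocus, Set.mem_ofPred_eq]
        constructor
        · rintro (h | h) _ ⟨F, hF, G, hG, rfl⟩
          · have h1 := h F hF
            simp only [evalAt, map_mul] at h1 ⊢
            simp [h1]
          · have h1 := h G hG
            simp only [evalAt, map_mul] at h1 ⊢
            simp [h1]
        · intro h
          by_contra hc
          push Not at hc
          obtain ⟨⟨F, hF, hF0⟩, ⟨G, hG, hG0⟩⟩ := hc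
          have h1 := h (F * G) ⟨F, hF, G, hG, rfl⟩
          simp only [evalAt, map_mul] at h1 hF0 hG0
          exact (mul_ne_zero hF0 hG0) h1)

/-- The dimension of a subset of `ℙ(V)`: the Krull dimension of the subset with the topology
induced by the Zariski topology. -/
def zariskiDim (T : Set (ℙ ℂ V)) : WithBot ℕ∞ :=
  @topologicalKrullDim T (TopologicalSpace.induced Subtype.val (zariskiTopology V))

end Projective

/-! ### Forms, the Veronese embedding -/

/-- The vector space `ℂ[z₀, …, zₙ]_d`. -/
abbrev Form (n d : ℕ) : Type := MvPolynomial.homogeneousSubmodule (Fin (n + 1)) ℂ d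

/-- `ℙⁿ = ℙ(ℂ[z₀, …, zₙ]₁)`. -/
abbrev Pn (n : ℕ) : Type := ℙ ℂ (Form n 1)

/-- The `d`-th power of a linear form. -/
def powForm {n : ℕ} (d : ℕ) (l : Form n 1) : Form n d :=
  ⟨(l : MvPolynomial (Fin (n + 1)) ℂ) ^ d, by
    have h := (show (l : MvPolynomial (Fin (n + 1)) ℂ).IsHomogeneous 1 from l.2).pow d
    rw [one_mul] at h
    exact h⟩

theorem powForm_ne_zero {n : ℕ} (d : ℕ) {l : Form n 1} (hl : l ≠ 0) : powForm d l ≠ 0 := by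
  intro h
  have h1 : (l : MvPolynomial (Fin (n + 1)) ℂ) ^ d = 0 := congrArg Subtype.val h
  exact hl (Subtype.ext (eq_zero_of_pow_eq_zero h1))

/-- The Veronese map `ν_d : ℙⁿ → ℙʳ`, `[ℓ] ↦ [ℓ ^ d]`. -/
def veronese (n d : ℕ) (p : Pn n) : ℙ ℂ (Form n d) :=
  Projectivization.mk ℂ (powForm d p.rep) (powForm_ne_zero d p.rep_nonzero)

theorem veronese_mk (n d : ℕ) (l : Form n 1) (hl : l ≠ 0) :
    veronese n d (Projectivization.mk ℂ l hl) =
      Projectivization.mk ℂ (powForm d l) (powForm_ne_zero d hl) := by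
  obtain ⟨a, ha⟩ := Projectivization.exists_smul_eq_mk_rep ℂ l hl
  rw [veronese, Projectivization.mk_eq_mk_iff']
  refine ⟨(a : ℂ) ^ d, ?_⟩
  apply Subtype.ext
  simp only [powForm, ← ha]
  simp [Units.smul_def, smul_pow]

/-- The Veronese variety `X = ν_d(ℙⁿ)`. -/
def veroneseVariety (n d : ℕ) : Set (ℙ ℂ (Form n d)) := Set.range (veronese n d)

/-! ### Linearly general position -/

/-- `A ⊆ ℙⁿ` is in linearly general position: every subset `B` of `A` spans a linear subspace of
dimension `min {n, |B| - 1}`. -/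
def LGP {n : ℕ} (A : Finset (Pn n)) : Prop :=
  ∀ B : Finset (Pn n), B ⊆ A →
    projDim (linSpan (B : Set (Pn n))) = min (n : ℤ) ((B.card : ℤ) - 1)

/-! ### The dimension of a family of finite sets of points

The symmetric product of `k` copies of `ℙⁿ = ℙ(ℂ[z₀, …, zₙ]₁)` is embedded in
`ℙ(ℂ[z₀, …, zₙ]_k)` as the closed set of forms that split in linear factors, by
`{[ℓ₁], …, [ℓ_k]} ↦ [ℓ₁ ⋯ ℓ_k]` (the Chow form of the zero-cycle). A family of sets of `k` points
of `ℙⁿ` is given the topology and hence the dimension which it has as a subset of this space. -/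

/-- The product of the linear forms defining the points of `A`. -/
def prodForm {n k : ℕ} (A : Finset (Pn n)) (hA : A.card = k) : Form n k :=
  ⟨∏ p ∈ A, (p.rep : MvPolynomial (Fin (n + 1)) ℂ), by
    have h := MvPolynomial.IsHomogeneous.prod A
      (fun p : Pn n => (p.rep : MvPolynomial (Fin (n + 1)) ℂ)) (fun _ => 1)
      (fun p _ => (show (p.rep : MvPolynomial (Fin (n + 1)) ℂ).IsHomogeneous 1 from p.rep.2))
    simp only [Finset.sum_const, smul_eq_mul, mul_one, hA] at h
    exact h⟩

theorem prodForm_ne_zero {n k : ℕ} (A : Finset (Pn n)) (hA : A.card = k) : prodForm A hA ≠ 0 := by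
  intro h
  have h1 : ∏ p ∈ A, (p.rep : MvPolynomial (Fin (n + 1)) ℂ) = 0 := congrArg Subtype.val h
  obtain ⟨p, -, hp⟩ := Finset.prod_eq_zero_iff.1 h1
  exact p.rep_nonzero (Subtype.ext hp)

/-- The Chow form of a set of `k` points of `ℙⁿ`. -/
def chowPoint {n k : ℕ} (A : Finset (Pn n)) (hA : A.card = k) : ℙ ℂ (Form n k) :=
  Projectivization.mk ℂ (prodForm A hA) (prodForm_ne_zero A hA)

/-- The dimension of a family of sets of `k` points of `ℙⁿ`. -/
def familyDim {n : ℕ} (k : ℕ) (T : Set (Finset (Pn n))) : WithBot ℕ∞ :=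
  zariskiDim {P : ℙ ℂ (Form n k) | ∃ (A : Finset (Pn n)) (hA : A.card = k),
    A ∈ T ∧ P = chowPoint A hA}

/-- The sets of points `A ⊆ ℙⁿ` such that `ν_d(A)` evinces the rank of `q` with respect to
`X = ν_d(ℙⁿ)`. -/
def rankDecompositions {n d : ℕ} (q : ℙ ℂ (Form n d)) : Set (Finset (Pn n)) :=
  {A | ∃ B ∈ evincing (veroneseVariety n d) q, A.card = B.card ∧
    veronese n d '' (A : Set (Pn n)) = (B : Set (ℙ ℂ (Form n d)))}

/-- The dimension of the set of subsets of `X = ν_d(ℙⁿ)` evincing the rank of `q`, where `X` is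
identified with `ℙⁿ` by the isomorphism `ν_d`. -/
def evincingDim {n d : ℕ} (q : ℙ ℂ (Form n d)) : WithBot ℕ∞ :=
  familyDim (xRank (veroneseVariety n d) q) (rankDecompositions q)

end

end Waring

open Waring

open scoped LinearAlgebra.Projectivization

namespace Waring

open Module

/-! ### Points, functionals and relations between squares -/

section Points

variable {V : Type*} [AddCommGroup V] [Module ℂ V]

/-! Write `S = S' ∪ {o}` and `q = ∑ c_p p⁴` with all `c_p ≠ 0`. Since `S` itself is not in LGP, `o`
lies in the span of at most `n` points of `S'`. Contracting a relation between squares with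
well-chosen functionals gives short linear relations between points, and general position then shows
that the squares of the points of `S` are independent (`SqRel.eq_zero`).

The catalecticant of `q` from degree 2 to degree 2 therefore has rank `2n + 1`, its image being the
span of these squares. So every decomposition has at least `2n + 1` points, and in one with exactly
`2n + 1` points every point has its square in that span (`QuarticEq.card_le_and_sq`). Such a point
`b`, if outside `S`, lies with `o` on a line through two points of `S'`, or else all points of `S'`
enter the relation (`SqRel.collinear_or`).

If `e ≥ 2`, no such line exists and `n ≥ 3`. Choose `T ⊆ S'` with `n` points whose span contains
`o`. Contractions put `b` in the span of `S' \ T` and determine the pairwise products of its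
coordinates up to a common factor (`SqRel.coordinates`), hence determine `b`. A quartic that
vanishes on `S` but not at `b` then excludes `b`, so the decomposition is unique.

If `e = 1`, then `o` lies on a line through `a, b ∈ S'`. For `n ≥ 3` all minimal decompositions
agree off this line; for `n = 2` a second line may occur (`exists_threeOn`). On the line there
remains a binary quartic with a three-term decomposition. Its three-term decompositions are the
square-free members of a pencil of apolar cubics. The Chow forms thus form an infinite subset of at
most two projective lines, which has dimension one; in particular `q` is not identifiable. The case
`e = 0` is impossible, as a single point cannot contain two points of `S`. -/

theorem submodule_linSpan (A : Set (ℙ ℂ V)) :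
    Projectivization.Subspace.submodule (linSpan A) =
      Submodule.span ℂ (Projectivization.rep '' A) := by
  apply le_antisymm
  · rw [← OrderIso.le_symm_apply, Projectivization.Subspace.span_le_subspace_iff]
    intro p hp
    rw [← p.mk_rep]
    exact (Submodule.mk_mem_projectivization_iff _ p.rep_nonzero).2
      (Submodule.subset_span ⟨p, hp, rfl⟩)
  · rw [Submodule.span_le]
    rintro _ ⟨p, hp, rfl⟩
    rw [SetLike.mem_coe, Projectivization.Subspace.mem_submodule_iff _ p.rep_nonzero, p.mk_rep]
    exact Projectivization.Subspace.subset_span A hp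

theorem mem_subspace_iff_rep (N : Projectivization.Subspace ℂ V) (p : ℙ ℂ V) :
    p ∈ N ↔ p.rep ∈ Projectivization.Subspace.submodule N := by
  rw [Projectivization.Subspace.mem_submodule_iff _ p.rep_nonzero, p.mk_rep]

theorem mem_linSpan_iff (A : Set (ℙ ℂ V)) (p : ℙ ℂ V) :
    p ∈ linSpan A ↔ p.rep ∈ Submodule.span ℂ (Projectivization.rep '' A) := by
  rw [mem_subspace_iff_rep, submodule_linSpan]

theorem mem_span_image_finset_iff {α : Type*} (f : α → V) (A : Finset α) (v : V) :
    v ∈ Submodule.span ℂ (f '' (A : Set α)) ↔ ∃ c : α → ℂ, ∑ x ∈ A, c x • f x = v := by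
  classical
  rw [Submodule.mem_span_image_finset_iff_exists_fun]
  constructor
  · rintro ⟨c, hc⟩
    refine ⟨fun x => if h : x ∈ A then c ⟨x, h⟩ else 0, ?_⟩
    rw [← hc, ← Finset.sum_coe_sort]
    exact Finset.sum_congr rfl fun x _ => by simp
  · rintro ⟨c, hc⟩
    exact ⟨fun x => c x, (Finset.sum_coe_sort A fun x => c x • f x).trans hc⟩

theorem eq_of_rep_smul {p p' : ℙ ℂ V} {a b : ℂ} (ha : a ≠ 0) (h : a • p.rep = b • p'.rep) :
    p = p' := by
  rw [← p.mk_rep, ← p'.mk_rep, Projectivization.mk_eq_mk_iff']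
  exact ⟨a⁻¹ * b, by rw [mul_smul, ← h, inv_smul_smul₀ ha]⟩

theorem exists_dual_of_notMem {W : Submodule ℂ V} {v : V} (h : v ∉ W) :
    ∃ φ : Dual ℂ V, φ v ≠ 0 ∧ ∀ w ∈ W, φ w = 0 := by
  obtain ⟨φ, h1, h2⟩ := Submodule.exists_le_ker_of_notMem h
  exact ⟨φ, h1, fun w hw => h2 hw⟩

theorem exists_dual_of_ne {p p' : ℙ ℂ V} (h : p ≠ p') :
    ∃ φ : Dual ℂ V, φ p.rep ≠ 0 ∧ φ p'.rep = 0 := by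
  obtain ⟨φ, h1, h2⟩ := exists_dual_of_notMem (W := Submodule.span ℂ {p'.rep}) (v := p.rep) (by
    intro hm
    obtain ⟨a, ha⟩ := Submodule.mem_span_singleton.1 hm
    exact h (eq_of_rep_smul one_ne_zero (by rw [one_smul, ha])))
  exact ⟨φ, h1, h2 _ (Submodule.mem_span_singleton_self _)⟩

theorem exists_dual_ne_zero_of_card_lt [FiniteDimensional ℂ V] (F : Finset V)
    (hF : F.card < finrank ℂ V) : ∃ φ : Dual ℂ V, φ ≠ 0 ∧ ∀ v ∈ F, φ v = 0 := by
  have hlt : Submodule.span ℂ (F : Set V) < ⊤ := by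
    apply Submodule.lt_top_of_finrank_lt_finrank
    exact (finrank_span_finset_le_card F).trans_lt hF
  obtain ⟨v, -, hv⟩ := SetLike.exists_of_lt hlt
  obtain ⟨φ, h1, h2⟩ := exists_dual_of_notMem hv
  exact ⟨φ, fun h => h1 (by simp [h]), fun w hw => h2 w (Submodule.subset_span hw)⟩

/-- Every subset of at most `dim V` points is linearly independent. -/
def GenPos (A : Finset (ℙ ℂ V)) : Prop :=
  ∀ F ⊆ A, F.card ≤ finrank ℂ V → LinearIndepOn ℂ Projectivization.rep (F : Set (ℙ ℂ V))

namespace GenPos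

variable {A : Finset (ℙ ℂ V)} (hA : GenPos A)
include hA

theorem eq_zero_of_sum {F : Finset (ℙ ℂ V)} (hF : F ⊆ A) (hc : F.card ≤ finrank ℂ V)
    {x : ℙ ℂ V → ℂ} (h : ∑ p ∈ F, x p • p.rep = 0) : ∀ p ∈ F, x p = 0 :=
  linearIndepOn_finset_iff.1 (hA F hF hc) x h

theorem notMem_span {F : Finset (ℙ ℂ V)} (hF : F ⊆ A) (hc : F.card < finrank ℂ V)
    {p : ℙ ℂ V} (hp : p ∈ A) (hpF : p ∉ F) :
    p.rep ∉ Submodule.span ℂ (Projectivization.rep '' (F : Set (ℙ ℂ V))) := by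
  classical
  have h := hA (insert p F) (Finset.insert_subset hp hF)
    ((Finset.card_insert_le _ _).trans hc)
  rw [Finset.coe_insert, linearIndepOn_insert (by simpa using hpF)] at h
  exact h.2

theorem exists_dual {F : Finset (ℙ ℂ V)} (hF : F ⊆ A) (hc : F.card < finrank ℂ V)
    {p : ℙ ℂ V} (hp : p ∈ A) (hpF : p ∉ F) :
    ∃ φ : Dual ℂ V, φ p.rep ≠ 0 ∧ ∀ s ∈ F, φ s.rep = 0 := by
  obtain ⟨φ, h1, h2⟩ := exists_dual_of_notMem (hA.notMem_span hF hc hp hpF)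
  exact ⟨φ, h1, fun s hs => h2 _ (Submodule.subset_span ⟨s, hs, rfl⟩)⟩

theorem span_eq_top [FiniteDimensional ℂ V] {F : Finset (ℙ ℂ V)} (hF : F ⊆ A)
    (hc : finrank ℂ V ≤ F.card) :
    Submodule.span ℂ (Projectivization.rep '' (F : Set (ℙ ℂ V))) = ⊤ := by
  obtain ⟨G, hGF, hG⟩ := Finset.exists_subset_card_eq hc
  have hli := hA G (hGF.trans hF) hG.le
  have h := hli.span_eq_top_of_card_eq_finrank' (by simp [hG])
  rw [eq_top_iff, ← h]
  apply Submodule.span_mono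
  rintro _ ⟨p, rfl⟩
  exact ⟨p, hGF p.2, rfl⟩

theorem dual_eq_zero [FiniteDimensional ℂ V] {F : Finset (ℙ ℂ V)} (hF : F ⊆ A)
    (hc : finrank ℂ V ≤ F.card) {φ : Dual ℂ V} (h : ∀ p ∈ F, φ p.rep = 0) : φ = 0 := by
  have h1 : Submodule.span ℂ (Projectivization.rep '' (F : Set (ℙ ℂ V))) ≤ LinearMap.ker φ := by
    rw [Submodule.span_le]
    rintro _ ⟨p, hp, rfl⟩
    exact h p hp
  rw [hA.span_eq_top hF hc, top_le_iff] at h1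
  exact LinearMap.ker_eq_top.1 h1

end GenPos

/-- A linear relation between the squares of the points of `A`. -/
def SqRel (A : Finset (ℙ ℂ V)) (c : ℙ ℂ V → ℂ) : Prop :=
  ∀ φ ψ : Dual ℂ V, ∑ p ∈ A, c p * (φ p.rep * ψ p.rep) = 0

/-- Pairing a quadratic tensor with one functional leaves a vector. A functional that vanishes at
many points turns a relation between squares into a short linear relation between points. -/
theorem SqRel.contract {A : Finset (ℙ ℂ V)} {c : ℙ ℂ V → ℂ} (h : SqRel A c) (φ : Dual ℂ V) :
    ∑ p ∈ A, (c p * φ p.rep) • p.rep = 0 := by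
  rw [← Module.forall_dual_apply_eq_zero_iff ℂ]
  intro ψ
  rw [map_sum, ← h φ ψ]
  exact Finset.sum_congr rfl fun p _ => by rw [map_smul, smul_eq_mul, mul_assoc]

/-- A functional which vanishes at all points of a relation but the points of an independent set
vanishes at all points with a nonzero coefficient. -/
theorem SqRel.mul_eq_zero_of_genPos {A S F : Finset (ℙ ℂ V)} {c : ℙ ℂ V → ℂ} (h : SqRel A c)
    (hS : GenPos S) (hFA : F ⊆ A) (hF : F ⊆ S) (hc : F.card ≤ finrank ℂ V) {φ : Dual ℂ V}
    (hφ : ∀ p ∈ A, p ∉ F → c p * φ p.rep = 0) : ∀ p ∈ A, c p * φ p.rep = 0 := by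
  intro p hp
  by_cases hpF : p ∈ F
  · have h1 := h.contract φ
    rw [← Finset.sum_subset hFA (fun x hx hxF => by rw [hφ x hx hxF, zero_smul])] at h1
    exact hS.eq_zero_of_sum hF hc h1 p hpF
  · exact hφ p hp hpF

/-- Contract with a functional that vanishes on `F` except at `w`, available because `F` is
independent. Of `F` only `w` survives, so it is balanced by points of `X`. -/
theorem SqRel.smul_mem_span {A S F : Finset (ℙ ℂ V)} {X : Set (ℙ ℂ V)} {c : ℙ ℂ V → ℂ}
    (h : SqRel A c)
    (hS : GenPos S) (hFA : F ⊆ A) (hF : F ⊆ S) (hc : F.card ≤ finrank ℂ V)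
    (hX : ∀ p ∈ A, p ∉ F → p ∉ X → c p = 0) {w : ℙ ℂ V} (hw : w ∈ F) :
    c w • w.rep ∈ Submodule.span ℂ (Projectivization.rep '' X) := by
  classical
  obtain ⟨φ, h1, h2⟩ := hS.exists_dual (F := F.erase w) ((Finset.erase_subset _ _).trans hF)
    ((Finset.card_erase_lt_of_mem hw).trans_le hc) (hF hw) (Finset.notMem_erase _ _)
  have h3 := h.contract φ
  rw [← Finset.add_sum_erase _ _ (hFA hw)] at h3
  have h4 : (c w * φ w.rep) • w.rep ∈ Submodule.span ℂ (Projectivization.rep '' X) := by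
    rw [eq_neg_of_add_eq_zero_left h3]
    refine Submodule.neg_mem _ (Submodule.sum_mem _ fun p hp => ?_)
    rw [Finset.mem_erase] at hp
    by_cases hpF : p ∈ F
    · rw [h2 p (Finset.mem_erase.2 ⟨hp.1, hpF⟩), mul_zero, zero_smul]
      exact Submodule.zero_mem _
    · by_cases hpX : p ∈ X
      · exact Submodule.smul_mem _ _ (Submodule.subset_span ⟨p, hpX, rfl⟩)
      · rw [hX p hp.2 hpF hpX, zero_mul, zero_smul]
        exact Submodule.zero_mem _
  have h5 := Submodule.smul_mem _ (φ w.rep)⁻¹ h4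
  rwa [smul_smul, mul_comm (c w), inv_mul_cancel_left₀ h1] at h5

end Points

/-! ### Independence of squares, and points whose square is dependent on them -/

section Squares

variable {V : Type*} [AddCommGroup V] [Module ℂ V] [FiniteDimensional ℂ V] {n : ℕ}
  {S' : Finset (ℙ ℂ V)}

theorem exists_dual_ne_zero_of_points (F : Finset (ℙ ℂ V))
    (hF : F.card < finrank ℂ V) :
    ∃ φ : Dual ℂ V, φ ≠ 0 ∧ ∀ p ∈ F, φ p.rep = 0 := by
  classical
  obtain ⟨φ, h0, h1⟩ := exists_dual_ne_zero_of_card_lt (F.image Projectivization.rep)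
    (Finset.card_image_le.trans_lt hF)
  exact ⟨φ, h0, fun p hp => h1 _ (Finset.mem_image_of_mem _ hp)⟩

/-- The squares of `2n` points in general position in `ℙⁿ` and of one more point are linearly
independent. -/
theorem SqRel.eq_zero [DecidableEq (ℙ ℂ V)] (hV : finrank ℂ V = n + 1) (hn : 1 ≤ n)
    (hS : GenPos S') (hcard : S'.card = 2 * n)
    {o : ℙ ℂ V} (ho : o ∉ S') {c : ℙ ℂ V → ℂ} (h : SqRel (insert o S') c) :
    ∀ p ∈ insert o S', c p = 0 := by
  -- With `n - 1` points in `U`, the points of `U` and `o` impose at most `n` conditions on `φ`,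
  -- while the `n + 1` points of `S' \ U` are still independent.
  obtain ⟨U, hUS, hU⟩ := Finset.exists_subset_card_eq (s := S') (n := n - 1) (by omega)
  obtain ⟨φ, hφ0, hφ⟩ := exists_dual_ne_zero_of_points (insert o U)
    (by have := Finset.card_insert_le o U; omega)
  have h1 := h.mul_eq_zero_of_genPos hS (F := S' \ U)
    (Finset.sdiff_subset.trans (Finset.subset_insert _ _)) Finset.sdiff_subset
    (by rw [Finset.card_sdiff_of_subset hUS]; omega) (φ := φ) (by
      intro p hp hpF
      rw [hφ p, mul_zero]
      simp only [Finset.mem_sdiff, not_and, not_not, Finset.mem_insert] at *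
      tauto)
  -- The nonzero `φ` vanishes at every point of the support in `S'`, whereas any `n + 1` points of
  -- `S'` span.
  have hW : (S'.filter fun p => c p ≠ 0).card ≤ n := by
    by_contra hlt
    refine hφ0 (hS.dual_eq_zero (F := S'.filter fun p => c p ≠ 0) (Finset.filter_subset _ S')
      (by omega) (φ := φ) fun p hp => ?_)
    rw [Finset.mem_filter] at hp
    exact (mul_eq_zero.1 (h1 p (Finset.mem_insert_of_mem hp.1))).resolve_left hp.2
  -- The support in `S'` is independent, so each of its points would be proportional to `o`.
  have h2 : ∀ p ∈ S', c p = 0 := by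
    intro p hp
    by_contra hcp
    have h3 := h.smul_mem_span hS (F := S'.filter fun p => c p ≠ 0) (X := {o})
      ((Finset.filter_subset _ _).trans (Finset.subset_insert _ _)) (Finset.filter_subset _ _)
      (by omega) (by
        intro x hx hxF hxo
        rw [Finset.mem_insert] at hx
        by_contra hx0
        exact hxF (Finset.mem_filter.2 ⟨hx.resolve_left hxo, hx0⟩))
      (Finset.mem_filter.2 ⟨hp, hcp⟩)
    rw [Set.image_singleton, Submodule.mem_span_singleton] at h3
    obtain ⟨a, ha⟩ := h3
    exact ho (eq_of_rep_smul hcp ha.symm ▸ hp)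
  intro p hp
  rcases Finset.mem_insert.1 hp with rfl | hp
  · obtain ⟨φ, h3, -⟩ := exists_dual_of_notMem (W := (⊥ : Submodule ℂ V)) (v := p.rep)
      (by simpa using p.rep_nonzero)
    have h4 := h φ φ
    rw [Finset.sum_insert ho, Finset.sum_eq_zero fun x hx => by rw [h2 x hx, zero_mul],
      add_zero] at h4
    simpa [h3] using h4
  · exact h2 p hp

/-- A point whose square is a combination of the squares of `2n` points in general position and of
a further point `o`. -/
theorem SqRel.collinear_or [DecidableEq (ℙ ℂ V)] (hV : finrank ℂ V = n + 1) (hn : 2 ≤ n)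
    (hS : GenPos S') (hcard : S'.card = 2 * n) {o b : ℙ ℂ V} (hob : o ≠ b)
    (ho : o ∉ S') (hb : b ∉ S') {c : ℙ ℂ V → ℂ} (h : SqRel (insert b (insert o S')) c)
    (hcb : c b ≠ 0) :
    (∃ s ∈ S', ∃ t ∈ S', s ≠ t ∧ o.rep ∈ Submodule.span ℂ {s.rep, t.rep} ∧
      b.rep ∈ Submodule.span ℂ {s.rep, t.rep}) ∨
    ((∀ p ∈ S', c p ≠ 0) ∧ ∀ U ⊆ S', U.card = n - 1 → ∀ φ : Dual ℂ V, (∀ p ∈ U, φ p.rep = 0) →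
      φ o.rep = 0 → φ b.rep = 0 → φ = 0) := by
  have hbA : b ∉ insert o S' := by simp [hob.symm, hb]
  have hSA : S' ⊆ insert b (insert o S') :=
    (Finset.subset_insert _ _).trans (Finset.subset_insert _ _)
  set W := S'.filter fun p => c p ≠ 0 with hWdef
  have hWS : W ⊆ S' := Finset.filter_subset _ _
  have hcW : ∀ p ∈ S', p ∉ W → c p = 0 := fun p hp hpW => by
    by_contra h0
    exact hpW (Finset.mem_filter.2 ⟨hp, h0⟩)
  -- A small support is independent, so it lies on the line `⟨b, o⟩`, and two of its points span
  -- that line. A large support contains `n + 1` points, enough to force a functional to vanish.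
  by_cases hW : W.card ≤ n
  · left
    have hmem : ∀ w ∈ W, w.rep ∈ Submodule.span ℂ {b.rep, o.rep} := by
      intro w hw
      have h3 := h.smul_mem_span hS (F := W) (X := {b, o}) (hWS.trans hSA) hWS (by omega) (by
        intro x hx hxF hxo
        simp only [Finset.mem_insert, Set.mem_insert_iff, Set.mem_singleton_iff, not_or] at hx hxo
        exact hcW x (by tauto) hxF) hw
      rw [Set.image_pair] at h3
      exact (Submodule.smul_mem_iff _ (Finset.mem_filter.1 hw).2).1 h3
    by_cases hW2 : 1 < W.card
    · obtain ⟨s, hs, t, ht, hst⟩ := Finset.one_lt_card.1 hW2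
      refine ⟨s, hWS hs, t, hWS ht, hst, ?_⟩
      have hli := hS {s, t} (by simp [Finset.insert_subset_iff, hWS hs, hWS ht])
        (by rw [Finset.card_pair hst]; omega)
      have hfin : finrank ℂ (Submodule.span ℂ {s.rep, t.rep}) = 2 := by
        classical
        rw [Finset.coe_pair] at hli
        have hne : s.rep ≠ t.rep := fun he => hst (eq_of_rep_smul one_ne_zero (by rw [he]))
        have h5 := finrank_span_finset_eq_card (s := {s.rep, t.rep}) (R := ℂ) (by
          have := hli.id_image
          rwa [Set.image_pair, ← Finset.coe_pair] at this)
        rwa [Finset.coe_pair, Finset.card_pair hne] at h5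
      have hle : Submodule.span ℂ {s.rep, t.rep} ≤ Submodule.span ℂ {b.rep, o.rep} := by
        rw [Submodule.span_le]
        rintro _ (rfl | rfl)
        · exact hmem s hs
        · exact hmem t ht
      have hle2 : finrank ℂ (Submodule.span ℂ {b.rep, o.rep}) ≤ 2 := by
        classical
        have := finrank_span_finset_le_card (R := ℂ) ({b.rep, o.rep} : Finset V)
        rw [Finset.coe_pair] at this
        exact this.trans Finset.card_le_two
      rw [Submodule.eq_of_le_of_finrank_le hle (by omega)]
      exact ⟨Submodule.subset_span (by simp), Submodule.subset_span (by simp)⟩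
    -- With at most one point `w` of `S'` involved, the product of a functional that kills `w` and
    -- one that kills `o` isolates `b`.
    · exfalso
      obtain ⟨w, hwS, hw⟩ : ∃ w ∈ S', ∀ p ∈ S', p ≠ w → c p = 0 := by
        have : Nonempty (ℙ ℂ V) := ⟨o⟩
        rcases Finset.card_le_one_iff_subset_singleton (s := W) |>.1 (by omega) with ⟨w, hw⟩
        by_cases hwS : w ∈ S'
        · exact ⟨w, hwS, fun p hp hpw => hcW p hp fun hpW => hpw (by simpa using hw hpW)⟩
        · obtain ⟨w', hw'⟩ : S'.Nonempty := by rw [← Finset.card_pos]; omega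
          refine ⟨w', hw', fun p hp _ => hcW p hp fun hpW => hwS ?_⟩
          have : p = w := by simpa using hw hpW
          exact this ▸ hp
      obtain ⟨φ, hφb, hφw⟩ := exists_dual_of_ne (p := b) (p' := w) (fun he => hb (he ▸ hwS))
      obtain ⟨ψ, hψb, hψo⟩ := exists_dual_of_ne (p := b) (p' := o) hob.symm
      have h4 := h φ ψ
      rw [Finset.sum_eq_single b] at h4
      · exact (mul_ne_zero hcb (mul_ne_zero hφb hψb)) h4
      · intro p hp hpb
        rcases Finset.mem_insert.1 ((Finset.mem_insert.1 hp).resolve_left hpb) with rfl | hp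
        · rw [hψo]; ring
        · by_cases hpw : p = w
          · rw [hpw, hφw]; ring
          · rw [hw p hp hpw]; ring
      · intro hb'
        exact absurd (Finset.mem_insert_self _ _) hb'
  · right
    -- Only `c p * φ p.rep = 0` is asked on `U`, so that points with zero coefficient impose no
    -- condition on `φ`.
    have key : ∀ U ⊆ S', U.card = n - 1 → ∀ φ : Dual ℂ V, (∀ p ∈ U, c p * φ p.rep = 0) →
        φ o.rep = 0 → φ b.rep = 0 → φ = 0 := by
      intro U hUS hU φ hφU hφo hφb
      have h1 := h.mul_eq_zero_of_genPos hS (F := S' \ U)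
        (Finset.sdiff_subset.trans hSA) Finset.sdiff_subset
        (by rw [Finset.card_sdiff_of_subset hUS]; omega) (φ := φ) (by
          intro p hp hpF
          simp only [Finset.mem_sdiff, not_and, not_not, Finset.mem_insert] at hp hpF
          rcases hp with rfl | rfl | hp
          · rw [hφb, mul_zero]
          · rw [hφo, mul_zero]
          · exact hφU p (hpF hp))
      refine hS.dual_eq_zero hWS (by omega) (φ := φ) fun p hp => ?_
      exact (mul_eq_zero.1 (h1 p (hSA (hWS hp)))).resolve_left (Finset.mem_filter.1 hp).2
    -- If `c p = 0`, then `p` completes a set of `n - 2` points to `U` for free. With `o` and `b`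
    -- only `n` conditions are imposed, so a nonzero `φ` contradicts `key`.
    refine ⟨fun p hp hcp => ?_, fun U hUS hU φ hφ => key U hUS hU φ
      fun p hp => by rw [hφ p hp, mul_zero]⟩
    obtain ⟨U, hUS, hU⟩ := Finset.exists_subset_card_eq (s := S'.erase p) (n := n - 2)
      (by rw [Finset.card_erase_of_mem hp]; omega)
    obtain ⟨φ, hφ0, hφ⟩ := exists_dual_ne_zero_of_points (insert b (insert o U)) (by
      have h1 := Finset.card_insert_le b (insert o U)
      have h2 := Finset.card_insert_le o U
      omega)
    have hpU : p ∉ U := fun hpU => Finset.notMem_erase p S' (hUS hpU)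
    refine hφ0 (key (insert p U)
      (Finset.insert_subset hp (hUS.trans (Finset.erase_subset _ _)))
      (by rw [Finset.card_insert_of_notMem hpU]; omega) φ ?_ (hφ _ (by simp)) (hφ _ (by simp)))
    intro x hx
    rcases Finset.mem_insert.1 hx with rfl | hx
    · rw [hcp, zero_mul]
    · rw [hφ x (by simp [hx]), mul_zero]

end Squares

/-! ### The residual point, and the catalecticant bound -/

section Octad

variable {V : Type*} [AddCommGroup V] [Module ℂ V] [FiniteDimensional ℂ V] {n : ℕ}
  {S' : Finset (ℙ ℂ V)}

/-- Let `T ⊆ S'` be half of `2n` points in general position and `o ∈ ⟨T⟩`. A point whose square is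
a generic combination of the squares of `o` and of the points of `S'` lies in the span of the other
half, and the products of its coordinates are determined up to a common factor. -/
theorem SqRel.coordinates [DecidableEq (ℙ ℂ V)] (hV : finrank ℂ V = n + 1) (hn : 2 ≤ n)
    (hS : GenPos S') (hcard : S'.card = 2 * n) {T : Finset (ℙ ℂ V)} (hT : T ⊆ S')
    (hTcard : T.card = n) {o : ℙ ℂ V} (ho : o ∉ S') {a : ℙ ℂ V → ℂ}
    (hoT : ∑ p ∈ T, a p • p.rep = o.rep) :
    ∃ (φ₀ : Dual ℂ V) (δ : ℙ ℂ V → Dual ℂ V) (Q : ℙ ℂ V → ℙ ℂ V → ℂ),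
      (∀ p ∈ T, φ₀ p.rep = 0) ∧ φ₀ o.rep = 0 ∧
      (∀ s ∈ S' \ T, ∀ t ∈ S' \ T, s ≠ t → δ s t.rep = 0) ∧
      ∀ (b : ℙ ℂ V) (c : ℙ ℂ V → ℂ), b ∉ S' → b ≠ o → SqRel (insert b (insert o S')) c →
        c b ≠ 0 → (∀ p ∈ S', c p ≠ 0) →
        φ₀ b.rep ≠ 0 ∧ ∃ (β : ℙ ℂ V → ℂ) (k : ℂ), k ≠ 0 ∧ (∀ s ∈ S' \ T, β s ≠ 0) ∧
          ∑ s ∈ S' \ T, β s • s.rep = b.rep ∧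
          (∀ s ∈ S' \ T, δ s b.rep = β s) ∧
          ∀ s ∈ S' \ T, ∀ t ∈ S' \ T, s ≠ t → β s * β t = k * Q s t := by
  have hR : S' \ T ⊆ S' := Finset.sdiff_subset
  have hRcard : (S' \ T).card = n := by rw [Finset.card_sdiff_of_subset hT]; omega
  -- `φ₀` and `ψ` define the hyperplanes spanned by the two halves of `S'`; by general position each
  -- is nonzero at every point of the opposite half.
  obtain ⟨φ₀, hφ0, hφT⟩ := exists_dual_ne_zero_of_points T (by omega)
  obtain ⟨ψ, hψ0, hψR⟩ := exists_dual_ne_zero_of_points (S' \ T) (by omega)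
  have hne : ∀ F ⊆ S', F.card = n → ∀ φ : Dual ℂ V, φ ≠ 0 → (∀ p ∈ F, φ p.rep = 0) →
      ∀ p ∈ S', p ∉ F → φ p.rep ≠ 0 := by
    intro F hF hFc φ h0 hφ p hp hpF h1
    refine h0 (hS.dual_eq_zero (F := insert p F) (Finset.insert_subset hp hF)
      (by rw [Finset.card_insert_of_notMem hpF]; omega) fun x hx => ?_)
    rcases Finset.mem_insert.1 hx with rfl | hx
    · exact h1
    · exact hφ x hx
  have hφR : ∀ p ∈ S' \ T, φ₀ p.rep ≠ 0 := fun p hp =>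
    hne T hT hTcard φ₀ hφ0 hφT p (hR hp) (Finset.mem_sdiff.1 hp).2
  have hψT : ∀ p ∈ T, ψ p.rep ≠ 0 := fun p hp =>
    hne _ hR hRcard ψ hψ0 hψR p (hT hp) fun h => (Finset.mem_sdiff.1 h).2 hp
  have hφo : φ₀ o.rep = 0 := by
    rw [← hoT, map_sum]
    exact Finset.sum_eq_zero fun p hp => by rw [map_smul, hφT p hp, smul_zero]
  have hδ : ∀ s : ℙ ℂ V, ∃ δ : Dual ℂ V, s ∈ S' \ T →
      δ s.rep = 1 ∧ ∀ t ∈ S' \ T, s ≠ t → δ t.rep = 0 := by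
    intro s
    by_cases hs : s ∈ S' \ T
    · obtain ⟨φ, h1, h2⟩ := hS.exists_dual (F := (S' \ T).erase s)
        ((Finset.erase_subset _ _).trans hR)
        (by rw [Finset.card_erase_of_mem hs]; omega) (hR hs) (Finset.notMem_erase _ _)
      refine ⟨(φ s.rep)⁻¹ • φ, fun _ => ⟨by simp [h1], fun t ht hst => ?_⟩⟩
      simp [h2 t (Finset.mem_erase.2 ⟨hst.symm, ht⟩)]
    · exact ⟨0, fun h => absurd h hs⟩
  choose δ hδ using hδ
  -- `Q s t` is the contribution of `o` and `T` to the relation tested on `δ s` and `δ t`, divided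
  -- by `c o`. It depends on neither `b` nor `c`.
  refine ⟨φ₀, δ, fun s t => δ s o.rep * δ t o.rep +
    ∑ p ∈ T, -(ψ o.rep * a p / ψ p.rep) * (δ s p.rep * δ t p.rep), hφT, hφo,
    fun s hs t ht hst => (hδ s hs).2 t ht hst, ?_⟩
  intro b c hb hbo h hcb hc
  have hbA : b ∉ insert o S' := by simp [hbo, hb]
  have hsplit : ∀ f : ℙ ℂ V → V, ∑ p ∈ insert b (insert o S'), f p =
      f b + (f o + (∑ p ∈ S' \ T, f p + ∑ p ∈ T, f p)) := by
    intro f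
    rw [Finset.sum_insert hbA, Finset.sum_insert ho, Finset.sum_sdiff hT]
  have hsplit' : ∀ f : ℙ ℂ V → ℂ, ∑ p ∈ insert b (insert o S'), f p =
      f b + (f o + (∑ p ∈ S' \ T, f p + ∑ p ∈ T, f p)) := by
    intro f
    rw [Finset.sum_insert hbA, Finset.sum_insert ho, Finset.sum_sdiff hT]
  -- This contraction removes `o` and `T` and expresses `b` through `S' \ T`. If `φ₀` vanished at
  -- `b`, the points of `S' \ T` would be dependent.
  have h1 := h.contract φ₀
  rw [hsplit, Finset.sum_eq_zero (s := T) fun p hp => by rw [hφT p hp, mul_zero, zero_smul],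
    hφo, mul_zero, zero_smul, zero_add, add_zero] at h1
  have hφb : φ₀ b.rep ≠ 0 := by
    intro h0
    rw [h0, mul_zero, zero_smul, zero_add] at h1
    obtain ⟨p, hp⟩ : (S' \ T).Nonempty := by rw [← Finset.card_pos]; omega
    exact mul_ne_zero (hc p (hR hp)) (hφR p hp)
      (hS.eq_zero_of_sum (x := fun p => c p * φ₀ p.rep) hR (by omega) h1 p hp)
  set β : ℙ ℂ V → ℂ := fun p => -((c b * φ₀ b.rep)⁻¹ * (c p * φ₀ p.rep)) with hβ
  have hbsum : ∑ s ∈ S' \ T, β s • s.rep = b.rep := by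
    have h2 : ∑ s ∈ S' \ T, β s • s.rep =
        -((c b * φ₀ b.rep)⁻¹ • ∑ s ∈ S' \ T, (c s * φ₀ s.rep) • s.rep) := by
      rw [Finset.smul_sum, ← Finset.sum_neg_distrib]
      exact Finset.sum_congr rfl fun s _ => by rw [hβ, neg_smul, smul_smul]
    rw [h2, eq_neg_of_add_eq_zero_right h1, smul_neg, neg_neg,
      inv_smul_smul₀ (mul_ne_zero hcb hφb)]
  have hδb : ∀ s ∈ S' \ T, δ s b.rep = β s := by
    intro s hs
    rw [← hbsum, map_sum, Finset.sum_eq_single s]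
    · rw [map_smul, (hδ s hs).1, smul_eq_mul, mul_one]
    · intro t ht hts
      rw [map_smul, (hδ s hs).2 t ht hts.symm, smul_zero]
    · exact fun h' => absurd hs h'
  have hψb : ψ b.rep = 0 := by
    rw [← hbsum, map_sum]
    exact Finset.sum_eq_zero fun p hp => by rw [map_smul, hψR p hp, smul_zero]
  -- This contraction removes `b` and `S' \ T`. Substituting `o = ∑ a p • p` expresses the
  -- coefficients on `T` through `c o`.
  have h3 := h.contract ψ
  rw [hsplit, Finset.sum_eq_zero (s := S' \ T) fun p hp => by
    rw [hψR p hp, mul_zero, zero_smul], hψb, mul_zero, zero_smul, zero_add, zero_add, ← hoT,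
    Finset.smul_sum, ← Finset.sum_add_distrib] at h3
  have hcT : ∀ p ∈ T, c p = c o * -(ψ o.rep * a p / ψ p.rep) := by
    intro p hp
    have h4 := hS.eq_zero_of_sum (F := T)
      (x := fun p => c o * ψ (∑ p ∈ T, a p • p.rep) * a p + c p * ψ p.rep) hT (by omega) (by
        rw [← h3]
        exact Finset.sum_congr rfl fun p _ => by rw [add_smul, smul_smul]) p hp
    rw [hoT] at h4
    have := hψT p hp
    field_simp
    linear_combination h4
  -- Otherwise the squares of `S'` and `b` would be dependent, against `SqRel.eq_zero` with `b` in
  -- the role of `o`.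
  have hco : c o ≠ 0 := by
    intro h0
    have h5 : SqRel (insert b S') c := by
      intro φ ψ'
      have := h φ ψ'
      rw [hsplit', h0, zero_mul, zero_add, Finset.sum_sdiff hT] at this
      rw [Finset.sum_insert hb, this]
    exact hcb (h5.eq_zero hV (by omega) hS hcard hb b (Finset.mem_insert_self _ _))
  refine ⟨hφb, β, -(c o / c b), neg_ne_zero.2 (div_ne_zero hco hcb), fun s hs => ?_, hbsum, hδb, ?_⟩
  · exact neg_ne_zero.2 (mul_ne_zero (inv_ne_zero (mul_ne_zero hcb hφb))
      (mul_ne_zero (hc s (hR hs)) (hφR s hs)))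
  · intro s hs t ht hst
    -- For `s ≠ t` every point of `S' \ T` is killed by `δ s` or `δ t`, so only `b`, `o` and `T`
    -- contribute.
    have h6 := h (δ s) (δ t)
    rw [hsplit', Finset.sum_eq_zero (s := S' \ T), hδb s hs, hδb t ht, zero_add] at h6
    · have h7 : ∑ p ∈ T, c p * (δ s p.rep * δ t p.rep) =
          c o * ∑ p ∈ T, -(ψ o.rep * a p / ψ p.rep) * (δ s p.rep * δ t p.rep) := by
        rw [Finset.mul_sum]
        refine Finset.sum_congr rfl fun p hp => ?_
        rw [hcT p hp]
        ring
      rw [h7] at h6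
      beta_reduce
      generalize ∑ p ∈ T, -(ψ o.rep * a p / ψ p.rep) * (δ s p.rep * δ t p.rep) = Z at h6 ⊢
      field_simp
      linear_combination h6
    · intro p hp
      by_cases hsp : s = p
      · rw [(hδ t ht).2 p hp (fun h' => hst (hsp.trans h'.symm))]
        ring
      · rw [(hδ s hs).2 p hp hsp]
        ring

/-- Equality of two combinations of fourth powers, tested on products of linear functionals. -/
def QuarticEq (A : Finset (ℙ ℂ V)) (d : ℙ ℂ V → ℂ) (B : Finset (ℙ ℂ V)) (c : ℙ ℂ V → ℂ) : Prop :=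
  ∀ φ₁ φ₂ φ₃ φ₄ : Dual ℂ V,
    ∑ p ∈ A, d p * (φ₁ p.rep * φ₂ p.rep * φ₃ p.rep * φ₄ p.rep) =
      ∑ p ∈ B, c p * (φ₁ p.rep * φ₂ p.rep * φ₃ p.rep * φ₄ p.rep)

omit [FiniteDimensional ℂ V] in
-- Catalecticant argument: fixing two of the four functionals gives an equality between combinations
-- of squares. As the squares of `B` are independent and the coefficients nonzero, the left-hand
-- sides generate every square of `B`. So the span of the squares of `A` contains that of `B`, and
-- dimensions give both claims.
theorem QuarticEq.card_le_and_sq {A B : Finset (ℙ ℂ V)} {d c : ℙ ℂ V → ℂ} (h : QuarticEq A d B c)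
    (hc : ∀ p ∈ B, c p ≠ 0) (hB : ∀ x : ℙ ℂ V → ℂ, SqRel B x → ∀ p ∈ B, x p = 0) :
    B.card ≤ A.card ∧ (A.card ≤ B.card → ∀ a ∈ A, ∃ x : ℙ ℂ V → ℂ, ∀ φ ψ : Dual ℂ V,
      φ a.rep * ψ a.rep = ∑ p ∈ B, x p * (φ p.rep * ψ p.rep)) := by
  classical
  set sq : ℙ ℂ V → (Dual ℂ V × Dual ℂ V → ℂ) := fun p f => f.1 p.rep * f.2 p.rep with hsq
  have hli : LinearIndepOn ℂ sq (B : Set (ℙ ℂ V)) := by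
    rw [linearIndepOn_finset_iff]
    intro x hx
    refine hB x fun φ ψ => ?_
    have := congrFun hx (φ, ψ)
    simpa [hsq] using this
  let Φ : (B → ℂ) →ₗ[ℂ] (Dual ℂ V × Dual ℂ V → ℂ) :=
    ∑ p : B, (LinearMap.proj p : (B → ℂ) →ₗ[ℂ] ℂ).smulRight (c p • sq p)
  have hΦ : ∀ y, Φ y = ∑ p : B, y p • (c p • sq p) := by
    intro y
    simp [Φ, LinearMap.sum_apply]
  -- Row rank equals column rank: by independence of the squares, the vectors `(φ p * ψ p)` indexed
  -- by `B` fill the coordinate space, so each coordinate vector is available below.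
  have htop : Submodule.span ℂ (Set.range (flip fun p : B => sq p)) = ⊤ :=
    span_flip_eq_top_iff_linearIndependent.2 hli
  have hrange : ∀ y, Φ y ∈ Submodule.span ℂ (sq '' (A : Set (ℙ ℂ V))) := by
    have h1 : Submodule.span ℂ (Set.range (flip fun p : B => sq p)) ≤
        (Submodule.span ℂ (sq '' (A : Set (ℙ ℂ V)))).comap Φ := by
      rw [Submodule.span_le]
      rintro _ ⟨⟨φ, ψ⟩, rfl⟩
      have h2 : Φ (flip (fun p : B => sq p) (φ, ψ)) =
          ∑ p ∈ A, (d p * (φ p.rep * ψ p.rep)) • sq p := by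
        rw [hΦ]
        ext ⟨φ', ψ'⟩
        have h3 := h φ ψ φ' ψ'
        rw [← Finset.sum_coe_sort B] at h3
        simp only [Finset.sum_apply, Pi.smul_apply, smul_eq_mul, flip, hsq]
        refine Eq.trans ?_ (h3.symm.trans ?_) <;> exact Finset.sum_congr rfl fun x _ => by ring
      rw [SetLike.mem_coe, Submodule.mem_comap, h2]
      exact Submodule.sum_mem _ fun p hp =>
        Submodule.smul_mem _ _ (Submodule.subset_span ⟨p, hp, rfl⟩)
    rw [htop] at h1
    exact fun y => h1 (Submodule.mem_top (x := y))
  have hle : Submodule.span ℂ (sq '' (B : Set (ℙ ℂ V))) ≤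
      Submodule.span ℂ (sq '' (A : Set (ℙ ℂ V))) := by
    rw [Submodule.span_le]
    rintro _ ⟨s, hs, rfl⟩
    have h1 := hrange (Pi.single ⟨s, hs⟩ 1)
    rw [hΦ, Finset.sum_eq_single ⟨s, hs⟩] at h1
    · rw [Pi.single_eq_same, one_smul] at h1
      exact (Submodule.smul_mem_iff _ (hc s hs)).1 h1
    · intro p _ hp
      rw [Pi.single_eq_of_ne hp, zero_smul]
    · simp
  have : FiniteDimensional ℂ (Submodule.span ℂ (sq '' (A : Set (ℙ ℂ V)))) :=
    FiniteDimensional.span_of_finite ℂ (A.finite_toSet.image _)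
  have hfB : finrank ℂ (Submodule.span ℂ (sq '' (B : Set (ℙ ℂ V)))) = B.card := by
    have := finrank_span_eq_card (R := ℂ) (b := fun p : B => sq p) hli
    rw [Fintype.card_coe] at this
    rw [← this, Set.image_eq_range]
    rfl
  have hfA : finrank ℂ (Submodule.span ℂ (sq '' (A : Set (ℙ ℂ V)))) ≤ A.card := by
    rw [← Finset.coe_image]
    exact (finrank_span_finset_le_card _).trans Finset.card_image_le
  refine ⟨by rw [← hfB]; exact (Submodule.finrank_mono hle).trans hfA, fun hcard a ha => ?_⟩
  have heq := Submodule.eq_of_le_of_finrank_le hle (by omega)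
  have hmem : sq a ∈ Submodule.span ℂ (sq '' (B : Set (ℙ ℂ V))) := by
    rw [heq]
    exact Submodule.subset_span ⟨a, ha, rfl⟩
  obtain ⟨x, hx⟩ := (mem_span_image_finset_iff sq B _).1 hmem
  refine ⟨x, fun φ ψ => ?_⟩
  have h1 := congrFun hx (φ, ψ)
  simp only [Finset.sum_apply, Pi.smul_apply, smul_eq_mul, hsq] at h1
  exact h1.symm

end Octad

/-! ### Uniqueness when `o` is on no line through two points of `S'` -/

section Uniqueness

variable {V : Type*} [AddCommGroup V] [Module ℂ V] [FiniteDimensional ℂ V] {n : ℕ}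
  {S' : Finset (ℙ ℂ V)}

omit [FiniteDimensional ℂ V] in
theorem QuarticEq.symm {A B : Finset (ℙ ℂ V)} {d c : ℙ ℂ V → ℂ} (h : QuarticEq A d B c) :
    QuarticEq B c A d :=
  fun φ₁ φ₂ φ₃ φ₄ => (h φ₁ φ₂ φ₃ φ₄).symm

omit [FiniteDimensional ℂ V] in
theorem sqRel_insert_of_eq [DecidableEq (ℙ ℂ V)] {S : Finset (ℙ ℂ V)} {b : ℙ ℂ V} (hb : b ∉ S)
    {x : ℙ ℂ V → ℂ}
    (h : ∀ φ ψ : Dual ℂ V, φ b.rep * ψ b.rep = ∑ p ∈ S, x p * (φ p.rep * ψ p.rep)) :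
    SqRel (insert b S) (fun p => if p = b then -1 else x p) := by
  intro φ ψ
  rw [Finset.sum_insert hb]
  beta_reduce
  rw [if_pos rfl, h φ ψ, neg_one_mul, neg_add_eq_zero]
  refine Finset.sum_congr rfl fun p hp => ?_
  rw [if_neg]
  rintro rfl
  exact hb hp

/-- All points of `A` outside `insert o S'` satisfy the same equations for products of coordinates,
so there is at most one such `b`. The quartic `φ₀² δ_s δ_t` vanishes on `T`, `o` and `S' \ T` but
not at `b`, which forces the coefficient of `b` to vanish. -/
theorem QuarticEq.eq_of_not_collinear [DecidableEq (ℙ ℂ V)] (hV : finrank ℂ V = n + 1) (hn : 3 ≤ n)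
    (hS : GenPos S') (hcard : S'.card = 2 * n) {T : Finset (ℙ ℂ V)} (hT : T ⊆ S')
    (hTcard : T.card = n) {o : ℙ ℂ V} (ho : o ∉ S') {a : ℙ ℂ V → ℂ}
    (hoT : ∑ p ∈ T, a p • p.rep = o.rep)
    (hcol : ∀ s ∈ S', ∀ t ∈ S', s ≠ t → o.rep ∉ Submodule.span ℂ {s.rep, t.rep})
    {A : Finset (ℙ ℂ V)} (hA : A.card = (insert o S').card) {d c : ℙ ℂ V → ℂ}
    (h : QuarticEq A d (insert o S') c) (hc : ∀ p ∈ insert o S', c p ≠ 0)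
    (hd : ∀ p ∈ A, d p ≠ 0) : A = insert o S' := by
  by_contra hne
  obtain ⟨b, hbA, hbS⟩ : ∃ b ∈ A, b ∉ insert o S' := by
    by_contra! hsub
    exact hne (Finset.eq_of_subset_of_card_le hsub hA.ge)
  obtain ⟨φ₀, δ, Q, hφT, hφo, hδ, hQ⟩ :=
    SqRel.coordinates hV (by omega) hS hcard hT hTcard ho hoT
  have hsq := (h.card_le_and_sq hc fun x hx =>
    SqRel.eq_zero hV (by omega) hS hcard ho hx).2 hA.le
  have key : ∀ b ∈ A, b ∉ insert o S' → φ₀ b.rep ≠ 0 ∧ ∃ (β : ℙ ℂ V → ℂ) (k : ℂ), k ≠ 0 ∧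
      (∀ s ∈ S' \ T, β s ≠ 0) ∧ ∑ s ∈ S' \ T, β s • s.rep = b.rep ∧
      (∀ s ∈ S' \ T, δ s b.rep = β s) ∧
      ∀ s ∈ S' \ T, ∀ t ∈ S' \ T, s ≠ t → β s * β t = k * Q s t := by
    intro b hbA hbS
    obtain ⟨x, hx⟩ := hsq b hbA
    have hrel := sqRel_insert_of_eq hbS hx
    rw [Finset.mem_insert, not_or] at hbS
    rcases hrel.collinear_or hV (by omega) hS hcard (Ne.symm hbS.1) ho hbS.2 (by simp) with
      ⟨s, hs, t, ht, hst, hos, -⟩ | ⟨h1, -⟩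
    · exact absurd hos (hcol s hs t ht hst)
    · exact hQ b _ hbS.2 hbS.1 hrel (by simp) h1
  have hRcard : (S' \ T).card = n := by rw [Finset.card_sdiff_of_subset hT]; omega
  have huniq : ∀ b' ∈ A, b' ∉ insert o S' → b' = b := by
    intro b' hbA' hbS'
    obtain ⟨-, β, k, hk, hβ, hsum, -, hprod⟩ := key b hbA hbS
    obtain ⟨-, β', k', hk', hβ', hsum', -, hprod'⟩ := key b' hbA' hbS'
    obtain ⟨s₀, hs₀⟩ : (S' \ T).Nonempty := by rw [← Finset.card_pos]; omega
    have hprop : ∀ s ∈ S' \ T, β s₀ * β' s = β' s₀ * β s := by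
      intro s hs
      by_cases hss : s = s₀
      · rw [hss, mul_comm]
      -- A third index exists because `n ≥ 3`. Comparing the products with `u` eliminates the
      -- unknown factors `k` and `k'`; for `n = 2` the argument breaks down here.
      · obtain ⟨u, hu⟩ : (((S' \ T).erase s).erase s₀).Nonempty := by
          rw [← Finset.card_pos, Finset.card_erase_of_mem, Finset.card_erase_of_mem hs]
          · omega
          · exact Finset.mem_erase.2 ⟨Ne.symm hss, hs₀⟩
        rw [Finset.mem_erase, Finset.mem_erase] at hu
        have e1 := hprod s hs u hu.2.2 hu.2.1.symm
        have e2 := hprod s₀ hs₀ u hu.2.2 hu.1.symm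
        have e3 := hprod' s hs u hu.2.2 hu.2.1.symm
        have e4 := hprod' s₀ hs₀ u hu.2.2 hu.1.symm
        apply mul_right_cancel₀ (mul_ne_zero (hβ u hu.2.2) (hβ' u hu.2.2))
        calc β s₀ * β' s * (β u * β' u) = (β s₀ * β u) * (β' s * β' u) := by ring
          _ = (β' s₀ * β' u) * (β s * β u) := by rw [e1, e2, e3, e4]; ring
          _ = β' s₀ * β s * (β u * β' u) := by ring
    refine eq_of_rep_smul (a := β s₀) (b := β' s₀) (hβ s₀ hs₀) ?_
    rw [← hsum, ← hsum', Finset.smul_sum, Finset.smul_sum]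
    exact Finset.sum_congr rfl fun s hs => by rw [smul_smul, smul_smul, hprop s hs]
  obtain ⟨hφb, β, k, hk, hβ, hsum, hδb, -⟩ := key b hbA hbS
  obtain ⟨s, hs, t, ht, hst⟩ := Finset.one_lt_card.1 (show 1 < (S' \ T).card by omega)
  have hvan : ∀ p ∈ insert o S', φ₀ p.rep * φ₀ p.rep * δ s p.rep * δ t p.rep = 0 := by
    intro p hp
    rcases Finset.mem_insert.1 hp with rfl | hp
    · rw [hφo]; ring
    · by_cases hpT : p ∈ T
      · rw [hφT p hpT]; ring
      · have hpR : p ∈ S' \ T := Finset.mem_sdiff.2 ⟨hp, hpT⟩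
        by_cases hps : s = p
        · rw [hδ t ht p hpR fun h' => hst (hps.trans h'.symm)]; ring
        · rw [hδ s hs p hpR hps]; ring
  have h1 := h φ₀ φ₀ (δ s) (δ t)
  rw [Finset.sum_eq_zero (s := insert o S') fun p hp => by rw [hvan p hp, mul_zero],
    Finset.sum_eq_single b] at h1
  · rw [hδb s hs, hδb t ht] at h1
    exact mul_ne_zero (hd b hbA)
      (mul_ne_zero (mul_ne_zero (mul_ne_zero hφb hφb) (hβ s hs)) (hβ t ht)) h1
  · intro p hpA hpb
    rw [hvan p, mul_zero]
    by_contra hpS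
    exact hpb (huniq p hpA hpS)
  · exact fun h' => absurd hbA h'

end Uniqueness

/-! ### Splitting a decomposition along a linear subspace -/

section Lines

open Classical in
/-- The points of `A` on the linear subspace defined by `L`. -/
noncomputable def ptsOn {V : Type*} [AddCommGroup V] [Module ℂ V] (L : Submodule ℂ V)
    (A : Finset (ℙ ℂ V)) : Finset (ℙ ℂ V) := A.filter fun p => p.rep ∈ L

open Classical in
/-- The points of `A` off the linear subspace defined by `L`. -/
noncomputable def ptsOff {V : Type*} [AddCommGroup V] [Module ℂ V] (L : Submodule ℂ V)
    (A : Finset (ℙ ℂ V)) : Finset (ℙ ℂ V) := A.filter fun p => p.rep ∉ L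

variable {V : Type*} [AddCommGroup V] [Module ℂ V]

theorem mem_ptsOn {L : Submodule ℂ V} {A : Finset (ℙ ℂ V)} {p : ℙ ℂ V} :
    p ∈ ptsOn L A ↔ p ∈ A ∧ p.rep ∈ L := by simp [ptsOn]

theorem mem_ptsOff {L : Submodule ℂ V} {A : Finset (ℙ ℂ V)} {p : ℙ ℂ V} :
    p ∈ ptsOff L A ↔ p ∈ A ∧ p.rep ∉ L := by simp [ptsOff]

theorem card_ptsOn_add_card_ptsOff (L : Submodule ℂ V) (A : Finset (ℙ ℂ V)) :
    (ptsOn L A).card + (ptsOff L A).card = A.card := by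
  classical
  rw [ptsOn, ptsOff]
  convert Finset.card_filter_add_card_filter_not (s := A) (fun p => p.rep ∈ L)

theorem sum_ptsOn_add_sum_ptsOff {M : Type*} [AddCommMonoid M] (L : Submodule ℂ V)
    (A : Finset (ℙ ℂ V)) (f : ℙ ℂ V → M) :
    ∑ p ∈ ptsOn L A, f p + ∑ p ∈ ptsOff L A, f p = ∑ p ∈ A, f p := by
  classical
  rw [ptsOn, ptsOff]
  convert Finset.sum_filter_add_sum_filter_not A (fun p => p.rep ∈ L) f

theorem sum_eq_sum_ptsOff {M : Type*} [AddCommMonoid M] (L : Submodule ℂ V)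
    (A : Finset (ℙ ℂ V)) (f : ℙ ℂ V → M) (h : ∀ p, p.rep ∈ L → f p = 0) :
    ∑ p ∈ A, f p = ∑ p ∈ ptsOff L A, f p := by
  rw [← sum_ptsOn_add_sum_ptsOff L A,
    Finset.sum_eq_zero fun p hp => h p (mem_ptsOn.1 hp).2, zero_add]

/-- Quartics which are products of linear forms separate the points of `P`, while they vanish
on `L`. -/
def SepOff (L : Submodule ℂ V) (P : Finset (ℙ ℂ V)) : Prop :=
  ∀ r ∈ P, ∃ φ₁ φ₂ φ₃ φ₄ : Dual ℂ V, φ₁ r.rep * φ₂ r.rep * φ₃ r.rep * φ₄ r.rep ≠ 0 ∧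
    ∀ p : ℙ ℂ V, p.rep ∈ L ∨ (p ∈ P ∧ p ≠ r) →
      φ₁ p.rep * φ₂ p.rep * φ₃ p.rep * φ₄ p.rep = 0

/-- A separating quartic isolates one point off `L`, so its two coefficients agree. The terms off
`L` then cancel. -/
theorem QuarticEq.ptsOn_of_ptsOff_eq {L : Submodule ℂ V} {A B : Finset (ℙ ℂ V)} {d c : ℙ ℂ V → ℂ}
    (h : QuarticEq A d B c) (hsep : SepOff L (ptsOff L B)) (hoff : ptsOff L A = ptsOff L B) :
    QuarticEq (ptsOn L A) d (ptsOn L B) c := by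
  have hdc : ∀ r ∈ ptsOff L B, d r = c r := by
    intro r hr
    obtain ⟨φ₁, φ₂, φ₃, φ₄, h1, h2⟩ := hsep r hr
    have h3 := h φ₁ φ₂ φ₃ φ₄
    rw [sum_eq_sum_ptsOff L A _ fun p hp => by rw [h2 p (Or.inl hp), mul_zero],
      sum_eq_sum_ptsOff L B _ fun p hp => by rw [h2 p (Or.inl hp), mul_zero], hoff,
      Finset.sum_eq_single_of_mem r hr, Finset.sum_eq_single_of_mem r hr] at h3
    rotate_left
    · intro p hp hpr
      rw [h2 p (Or.inr ⟨hp, hpr⟩), mul_zero]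
    · intro p hp hpr
      rw [h2 p (Or.inr ⟨hp, hpr⟩), mul_zero]
    exact mul_right_cancel₀ h1 h3
  intro φ₁ φ₂ φ₃ φ₄
  have h3 := h φ₁ φ₂ φ₃ φ₄
  rw [← sum_ptsOn_add_sum_ptsOff L A, ← sum_ptsOn_add_sum_ptsOff L B, hoff,
    Finset.sum_congr (s₁ := ptsOff L B) rfl fun p hp => by rw [hdc p hp]] at h3
  exact add_right_cancel h3

/-- Dropping a point with zero coefficient would leave fewer points than the catalecticant bound
permits. -/
theorem QuarticEq.coeff_ne_zero {A B : Finset (ℙ ℂ V)} {d c : ℙ ℂ V → ℂ} (h : QuarticEq A d B c)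
    (hc : ∀ p ∈ B, c p ≠ 0) (hB : ∀ x : ℙ ℂ V → ℂ, SqRel B x → ∀ p ∈ B, x p = 0)
    (hcard : A.card ≤ B.card) : ∀ p ∈ A, d p ≠ 0 := by
  classical
  intro p hp h0
  have h1 : QuarticEq (A.erase p) d B c := by
    intro φ₁ φ₂ φ₃ φ₄
    rw [← h φ₁ φ₂ φ₃ φ₄, ← Finset.add_sum_erase A _ hp, h0, zero_mul, zero_add]
  have h2 := (h1.card_le_and_sq hc hB).1
  have h3 := Finset.card_erase_lt_of_mem hp
  omega

/-- One linear factor disposes of one point; three such steps give the cubic of `exists_cubic`. -/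
theorem exists_dual_step (p₀ : ℙ ℂ V) (k : ℕ) (F : Finset (ℙ ℂ V)) (hF : F.card ≤ k + 1)
    (h0 : p₀ ∉ F) : ∃ ψ : Dual ℂ V, ψ p₀.rep ≠ 0 ∧ ∃ F' : Finset (ℙ ℂ V), F'.card ≤ k ∧ p₀ ∉ F' ∧
      ∀ p ∈ F, ψ p.rep = 0 ∨ p ∈ F' := by
  classical
  rcases F.eq_empty_or_nonempty with rfl | ⟨p, hp⟩
  · obtain ⟨ψ, h1, -⟩ := exists_dual_of_notMem (W := (⊥ : Submodule ℂ V)) (v := p₀.rep)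
      (by simpa using p₀.rep_nonzero)
    exact ⟨ψ, h1, ∅, by simp, by simp, by simp⟩
  · obtain ⟨ψ, h1, h2⟩ := exists_dual_of_ne (p := p₀) (p' := p) (fun h => h0 (h ▸ hp))
    refine ⟨ψ, h1, F.erase p, by rw [Finset.card_erase_of_mem hp]; omega,
      fun h => h0 (Finset.mem_of_mem_erase h), fun x hx => ?_⟩
    by_cases hxp : x = p
    · exact Or.inl (hxp ▸ h2)
    · exact Or.inr (Finset.mem_erase.2 ⟨hxp, hx⟩)

theorem exists_cubic (p₀ : ℙ ℂ V) (F : Finset (ℙ ℂ V)) (hF : F.card ≤ 3) (h0 : p₀ ∉ F) :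
    ∃ ψ₁ ψ₂ ψ₃ : Dual ℂ V, ψ₁ p₀.rep * ψ₂ p₀.rep * ψ₃ p₀.rep ≠ 0 ∧
      ∀ p ∈ F, ψ₁ p.rep * ψ₂ p.rep * ψ₃ p.rep = 0 := by
  obtain ⟨ψ₁, a1, F₁, b1, c1, d1⟩ := exists_dual_step p₀ 2 F hF h0
  obtain ⟨ψ₂, a2, F₂, b2, c2, d2⟩ := exists_dual_step p₀ 1 F₁ b1 c1
  obtain ⟨ψ₃, a3, F₃, b3, c3, d3⟩ := exists_dual_step p₀ 0 F₂ b2 c2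
  refine ⟨ψ₁, ψ₂, ψ₃, mul_ne_zero (mul_ne_zero a1 a2) a3, fun p hp => ?_⟩
  rcases d1 p hp with h | h
  · simp [h]
  rcases d2 p h with h | h
  · simp [h]
  rcases d3 p h with h | h
  · simp [h]
  rw [Nat.le_zero, Finset.card_eq_zero] at b3
  simp [b3] at h

/-- The cubes of at most four distinct points are linearly independent. -/
theorem subset_of_cubic_eq {X Y : Finset (ℙ ℂ V)} {w z : ℙ ℂ V → ℂ}
    (hXY : X.card + Y.card ≤ 4) (hz : ∀ p ∈ Y, z p ≠ 0)
    (h : ∀ ψ₁ ψ₂ ψ₃ : Dual ℂ V, ∑ p ∈ X, w p * (ψ₁ p.rep * ψ₂ p.rep * ψ₃ p.rep) =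
      ∑ p ∈ Y, z p * (ψ₁ p.rep * ψ₂ p.rep * ψ₃ p.rep)) : Y ⊆ X := by
  classical
  intro p₀ hp₀
  by_contra hX
  obtain ⟨ψ₁, ψ₂, ψ₃, h1, h2⟩ := exists_cubic p₀ (X ∪ Y.erase p₀) (by
      have := Finset.card_union_le X (Y.erase p₀)
      rw [Finset.card_erase_of_mem hp₀] at this
      have := Finset.card_pos.2 ⟨p₀, hp₀⟩
      omega) (by simp [hX])
  have h3 := h ψ₁ ψ₂ ψ₃
  rw [Finset.sum_eq_zero fun p hp => by rw [h2 p (Finset.mem_union_left _ hp), mul_zero],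
    Finset.sum_eq_single_of_mem p₀ hp₀ fun p hp hpp => by
      rw [h2 p (Finset.mem_union_right _ (Finset.mem_erase.2 ⟨hpp, hp⟩)), mul_zero]] at h3
  exact mul_ne_zero (hz p₀ hp₀) h1 h3.symm

/-- Contracting with `φ` kills the points of the hyperplane and leaves an equality of cubes with
nonzero coefficients, involving at most four points. -/
theorem QuarticEq.ptsOff_eq {A B : Finset (ℙ ℂ V)} {d c : ℙ ℂ V → ℂ} (h : QuarticEq A d B c)
    (hd : ∀ p ∈ A, d p ≠ 0) (hc : ∀ p ∈ B, c p ≠ 0) {φ : Dual ℂ V}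
    (hcard : (ptsOff (LinearMap.ker φ) A).card + (ptsOff (LinearMap.ker φ) B).card ≤ 4) :
    ptsOff (LinearMap.ker φ) A = ptsOff (LinearMap.ker φ) B := by
  have key : ∀ {A B : Finset (ℙ ℂ V)} {d c : ℙ ℂ V → ℂ}, QuarticEq A d B c →
      (∀ p ∈ B, c p ≠ 0) →
      (ptsOff (LinearMap.ker φ) A).card + (ptsOff (LinearMap.ker φ) B).card ≤ 4 →
      ptsOff (LinearMap.ker φ) B ⊆ ptsOff (LinearMap.ker φ) A := by
    intro A B d c h hc hcard
    refine subset_of_cubic_eq (w := fun p => d p * φ p.rep) (z := fun p => c p * φ p.rep) hcard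
      (fun p hp => mul_ne_zero (hc p (mem_ptsOff.1 hp).1) (mem_ptsOff.1 hp).2) ?_
    intro ψ₁ ψ₂ ψ₃
    have h1 := h φ ψ₁ ψ₂ ψ₃
    have h0 : ∀ (w : ℙ ℂ V → ℂ) (p : ℙ ℂ V), p.rep ∈ LinearMap.ker φ →
        w p * (φ p.rep * ψ₁ p.rep * ψ₂ p.rep * ψ₃ p.rep) = 0 := by
      intro w p hp
      rw [LinearMap.mem_ker.1 hp]
      ring
    rw [sum_eq_sum_ptsOff _ A _ (h0 d), sum_eq_sum_ptsOff _ B _ (h0 c)] at h1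
    refine Eq.trans ?_ (h1.trans ?_) <;> exact Finset.sum_congr rfl fun x _ => by ring
  exact Finset.Subset.antisymm (key h.symm hd (by omega)) (key h hc hcard)

/-- `A` has three points on the line defined by `L`, nonzero coefficients, and its points off the
line are separated by quartics which vanish on the line. -/
structure ThreeOn (L : Submodule ℂ V) (A : Finset (ℙ ℂ V)) (d : ℙ ℂ V → ℂ) : Prop where
  finrank_eq : finrank ℂ L = 2
  coeff_ne : ∀ p ∈ A, d p ≠ 0
  card_eq : (ptsOn L A).card = 3
  sep : SepOff L (ptsOff L A)

end Lines

/-! ### Decompositions when `o` is collinear with two points of `S'` -/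

section Collinear

variable {V : Type*} [AddCommGroup V] [Module ℂ V] [FiniteDimensional ℂ V] {n : ℕ}
  {S' : Finset (ℙ ℂ V)}

omit [FiniteDimensional ℂ V] in
theorem dual_eq_zero_of_mem_span_pair {φ : Dual ℂ V} {u v w : V} (hu : φ u = 0) (hv : φ v = 0)
    (hw : w ∈ Submodule.span ℂ {u, v}) : φ w = 0 := by
  obtain ⟨x, y, rfl⟩ := Submodule.mem_span_pair.1 hw
  simp [hu, hv]

omit [FiniteDimensional ℂ V] in
theorem GenPos.finrank_span_pair [DecidableEq (ℙ ℂ V)] (hS : GenPos S')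
    (hV : 2 ≤ finrank ℂ V) {a b : ℙ ℂ V} (ha : a ∈ S') (hb : b ∈ S') (hab : a ≠ b) :
    finrank ℂ (Submodule.span ℂ {a.rep, b.rep}) = 2 := by
  classical
  have hli := hS {a, b} (by simp [Finset.insert_subset_iff, ha, hb])
    (by rw [Finset.card_pair hab]; omega)
  rw [Finset.coe_pair] at hli
  have hne : a.rep ≠ b.rep := fun he => hab (eq_of_rep_smul one_ne_zero (by rw [he]))
  have h5 := finrank_span_finset_eq_card (s := {a.rep, b.rep}) (R := ℂ) (by
    have := hli.id_image
    rwa [Set.image_pair, ← Finset.coe_pair] at this)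
  rwa [Finset.coe_pair, Finset.card_pair hne] at h5

omit [FiniteDimensional ℂ V] in
/-- The points of `S' ∪ {o}` off the line through `a, b ∈ S'` and `o`. -/
theorem ptsOff_insert [DecidableEq (ℙ ℂ V)] (hV : finrank ℂ V = n + 1) (hn : 2 ≤ n)
    (hS : GenPos S') {o a b : ℙ ℂ V} (ha : a ∈ S') (hb : b ∈ S')
    (ho : o.rep ∈ Submodule.span ℂ {a.rep, b.rep}) :
    ptsOff (Submodule.span ℂ {a.rep, b.rep}) (insert o S') = (S'.erase a).erase b := by
  ext p
  rw [mem_ptsOff, Finset.mem_insert, Finset.mem_erase, Finset.mem_erase]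
  constructor
  · rintro ⟨rfl | hp, hpL⟩
    · exact absurd ho hpL
    · refine ⟨?_, ?_, hp⟩
      · rintro rfl
        exact hpL (Submodule.subset_span (by simp))
      · rintro rfl
        exact hpL (Submodule.subset_span (by simp))
  · rintro ⟨hpb, hpa, hp⟩
    refine ⟨Or.inr hp, ?_⟩
    have := hS.notMem_span (F := {a, b}) (by simp [Finset.insert_subset_iff, ha, hb])
      (by have := Finset.card_le_two (a := a) (b := b); omega) hp (by simp [hpa, hpb])
    rwa [Finset.coe_pair, Set.image_pair] at this

omit [FiniteDimensional ℂ V] in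
theorem threeOn_insert [DecidableEq (ℙ ℂ V)] (hV : finrank ℂ V = n + 1) (hn : 2 ≤ n)
    (hS : GenPos S') (hcard : S'.card = 2 * n) {o a b : ℙ ℂ V} (hoS : o ∉ S') (ha : a ∈ S')
    (hb : b ∈ S') (hab : a ≠ b) (ho : o.rep ∈ Submodule.span ℂ {a.rep, b.rep}) {c : ℙ ℂ V → ℂ}
    (hc : ∀ p ∈ insert o S', c p ≠ 0) :
    ThreeOn (Submodule.span ℂ {a.rep, b.rep}) (insert o S') c := by
  have hoff := ptsOff_insert hV hn hS ha hb ho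
  have hRcard : ((S'.erase a).erase b).card = 2 * n - 2 := by
    rw [Finset.card_erase_of_mem (Finset.mem_erase.2 ⟨hab.symm, hb⟩), Finset.card_erase_of_mem ha]
    omega
  refine ⟨hS.finrank_span_pair (by omega) ha hb hab, hc, ?_, ?_⟩
  · have := card_ptsOn_add_card_ptsOff (Submodule.span ℂ {a.rep, b.rep}) (insert o S')
    rw [hoff, hRcard, Finset.card_insert_of_notMem hoS] at this
    omega
  · rw [hoff]
    intro r hr
    have hr' := hr
    rw [Finset.mem_erase, Finset.mem_erase] at hr'
    have hRS : ((S'.erase a).erase b).erase r ⊆ S' :=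
      ((Finset.erase_subset _ _).trans (Finset.erase_subset _ _)).trans (Finset.erase_subset _ _)
    -- The separating quartic is `φ² ψ²`: `φ` vanishes at `a`, `b` and `n - 2` of the `2n - 3` other
    -- points off the line, `ψ` at the remaining `n - 1`.
    obtain ⟨U, hU, hUcard⟩ := Finset.exists_subset_card_eq
      (s := ((S'.erase a).erase b).erase r) (n := n - 2)
      (by rw [Finset.card_erase_of_mem hr]; omega)
    have hrU : r ∉ U := fun h => Finset.notMem_erase r _ (hU h)
    obtain ⟨φ, hφr, hφ⟩ := hS.exists_dual (F := insert a (insert b U))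
      (Finset.insert_subset ha (Finset.insert_subset hb (hU.trans hRS)))
      (by
        have h1 := Finset.card_insert_le a (insert b U)
        have h2 := Finset.card_insert_le b U
        omega) hr'.2.2 (by simp [hr'.1, hr'.2.1, hrU])
    obtain ⟨ψ, hψr, hψ⟩ := hS.exists_dual (F := ((S'.erase a).erase b).erase r \ U)
      (Finset.sdiff_subset.trans hRS)
      (by rw [Finset.card_sdiff_of_subset hU, Finset.card_erase_of_mem hr]; omega) hr'.2.2
      (by simp)
    refine ⟨φ, φ, ψ, ψ, by simp [hφr, hψr], ?_⟩
    rintro p (hp | ⟨hp, hpr⟩)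
    · rw [dual_eq_zero_of_mem_span_pair (hφ a (by simp)) (hφ b (by simp)) hp]
      ring
    · by_cases hpU : p ∈ U
      · rw [hφ p (by simp [hpU])]
        ring
      · rw [hψ p (Finset.mem_sdiff.2 ⟨Finset.mem_erase.2 ⟨hpr, hp⟩, hpU⟩)]
        ring

/-- For `n ≥ 3` the line through `a` and `b` is the only one through two points of `S'` that
contains `o`, and the second alternative of `SqRel.collinear_or` is impossible. So `A` has no new
point off the line, and separating quartics show that no old one is missing. -/
theorem QuarticEq.ptsOff_eq_of_three_le [DecidableEq (ℙ ℂ V)] (hV : finrank ℂ V = n + 1)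
    (hn : 3 ≤ n)
    (hS : GenPos S') (hcard : S'.card = 2 * n) {o a b : ℙ ℂ V} (hoS : o ∉ S') (ha : a ∈ S')
    (hb : b ∈ S') (hab : a ≠ b) (ho : o.rep ∈ Submodule.span ℂ {a.rep, b.rep})
    {A : Finset (ℙ ℂ V)} (hA : A.card = (insert o S').card) {d c : ℙ ℂ V → ℂ}
    (h : QuarticEq A d (insert o S') c) (hc : ∀ p ∈ insert o S', c p ≠ 0) :
    ptsOff (Submodule.span ℂ {a.rep, b.rep}) A =
      ptsOff (Submodule.span ℂ {a.rep, b.rep}) (insert o S') := by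
  have hsq := (h.card_le_and_sq hc fun x hx =>
    SqRel.eq_zero hV (by omega) hS hcard hoS hx).2 hA.le
  have hpair : ∀ s ∈ S', ∀ t ∈ S', s ≠ t → o.rep ∈ Submodule.span ℂ {s.rep, t.rep} →
      s = a ∨ s = b := by
    intro s hs t ht hst hos
    by_contra! hne
    obtain ⟨φ, hφs, hφ⟩ := hS.exists_dual (F := {a, b, t})
      (by simp [Finset.insert_subset_iff, ha, hb, ht])
      (by have := Finset.card_le_three (a := a) (b := b) (c := t); omega) hs
      (by simp [hne.1, hne.2, hst])
    have hφo := dual_eq_zero_of_mem_span_pair (hφ a (by simp)) (hφ b (by simp)) ho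
    obtain ⟨x, y, hxy⟩ := Submodule.mem_span_pair.1 hos
    have hx : x = 0 := by
      rw [← hxy, map_add, map_smul, map_smul, hφ t (by simp), smul_zero, add_zero] at hφo
      exact (smul_eq_zero.1 hφo).resolve_right hφs
    rw [hx, zero_smul, zero_add] at hxy
    exact hoS (eq_of_rep_smul (one_ne_zero) ((one_smul ℂ o.rep).trans hxy.symm) ▸ ht)
  have hsub : ptsOff (Submodule.span ℂ {a.rep, b.rep}) A ⊆
      ptsOff (Submodule.span ℂ {a.rep, b.rep}) (insert o S') := by
    intro p hp
    rw [mem_ptsOff] at hp ⊢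
    refine ⟨?_, hp.2⟩
    by_contra hpS
    obtain ⟨x, hx⟩ := hsq p hp.1
    have hrel := sqRel_insert_of_eq hpS hx
    rw [Finset.mem_insert, not_or] at hpS
    rcases hrel.collinear_or hV (by omega) hS hcard (Ne.symm hpS.1) hoS hpS.2 (by simp) with
      ⟨s, hs, t, ht, hst, hos, hps⟩ | ⟨-, h2⟩
    · have h3 := hpair s hs t ht hst hos
      have h4 := hpair t ht s hs hst.symm (by rwa [Set.pair_comm])
      rcases h3 with rfl | rfl <;> rcases h4 with rfl | rfl
      · exact hst rfl
      · exact hp.2 hps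
      · exact hp.2 (by rwa [Set.pair_comm])
      · exact hst rfl
    -- `U` can contain both `a` and `b` because `n - 1 ≥ 2`. Vanishing at `o` then comes for free,
    -- so `U` and `p` impose only `n` conditions.
    · obtain ⟨U, hUab, hUS, hU⟩ := Finset.exists_subsuperset_card_eq (s := {a, b}) (t := S')
        (n := n - 1) (by simp [Finset.insert_subset_iff, ha, hb])
        (by rw [Finset.card_pair hab]; omega) (by omega)
      obtain ⟨φ, hφ0, hφ⟩ := exists_dual_ne_zero_of_points (insert p U)
        (by have := Finset.card_insert_le p U; omega)
      refine hφ0 (h2 U hUS hU φ (fun x hx => hφ x (by simp [hx])) ?_ (hφ p (by simp)))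
      exact dual_eq_zero_of_mem_span_pair (hφ a (Finset.mem_insert_of_mem (hUab (by simp))))
        (hφ b (Finset.mem_insert_of_mem (hUab (by simp)))) ho
  refine Finset.Subset.antisymm hsub fun r hr => ?_
  obtain ⟨φ₁, φ₂, φ₃, φ₄, h1, h2⟩ :=
    (threeOn_insert hV (by omega) hS hcard hoS ha hb hab ho hc).sep r hr
  by_contra hrA
  have h3 := h φ₁ φ₂ φ₃ φ₄
  rw [sum_eq_sum_ptsOff _ A _ fun p hp => by rw [h2 p (Or.inl hp), mul_zero],
    sum_eq_sum_ptsOff _ (insert o S') _ fun p hp => by rw [h2 p (Or.inl hp), mul_zero],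
    Finset.sum_eq_zero, Finset.sum_eq_single_of_mem r hr] at h3
  · exact mul_ne_zero (hc r (mem_ptsOff.1 hr).1) h1 h3.symm
  · intro p hp hpr
    rw [h2 p (Or.inr ⟨hp, hpr⟩), mul_zero]
  · intro p hp
    rw [h2 p (Or.inr ⟨hsub hp, fun hpr => hrA (hpr ▸ hp)⟩), mul_zero]

/-- All the decompositions of length `2n + 1` differ from one of two given ones only at points of
a line. -/
theorem exists_threeOn [DecidableEq (ℙ ℂ V)] (hV : finrank ℂ V = n + 1) (hn : 2 ≤ n)
    (hS : GenPos S') (hcard : S'.card = 2 * n) {o a b : ℙ ℂ V} (hoS : o ∉ S') (ha : a ∈ S')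
    (hb : b ∈ S') (hab : a ≠ b) (ho : o.rep ∈ Submodule.span ℂ {a.rep, b.rep}) {c : ℙ ℂ V → ℂ}
    (hc : ∀ p ∈ insert o S', c p ≠ 0) :
    ∃ (L : Fin 2 → Submodule ℂ V) (B : Fin 2 → Finset (ℙ ℂ V)) (f : Fin 2 → ℙ ℂ V → ℂ),
      (∀ i, ThreeOn (L i) (B i) (f i)) ∧ (∀ i, (B i).card = 2 * n + 1) ∧ (∀ i, QuarticEq (B i) (f i) (insert o S') c) ∧
      ∀ (A : Finset (ℙ ℂ V)) (d : ℙ ℂ V → ℂ), A.card = 2 * n + 1 →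
        QuarticEq A d (insert o S') c → ∃ i, ptsOff (L i) A = ptsOff (L i) (B i) := by
  have hScard : (insert o S').card = 2 * n + 1 := by
    rw [Finset.card_insert_of_notMem hoS, hcard]
  have hthree := threeOn_insert hV hn hS hcard hoS ha hb hab ho hc
  have hrefl : QuarticEq (insert o S') c (insert o S') c := fun _ _ _ _ => rfl
  have hind := fun x hx => SqRel.eq_zero (c := x) hV (by omega) hS hcard hoS hx
  -- For `n ≥ 3` both indices carry the same data. In the plane, the line `ψ = 0` through the other
  -- two points of `S'` may carry a second family.
  rcases hn.lt_or_eq with hn3 | rfl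
  · exact ⟨fun _ => _, fun _ => _, fun _ => c, fun _ => hthree, fun _ => hScard, fun _ => hrefl,
      fun A d hA h => ⟨0, h.ptsOff_eq_of_three_le hV hn3 hS hcard hoS ha hb hab ho
        (hA.trans hScard.symm) hc⟩⟩
  have hoff := ptsOff_insert hV hn hS ha hb ho
  set R := (S'.erase a).erase b with hR
  have hRcard : R.card = 2 := by
    rw [hR, Finset.card_erase_of_mem (Finset.mem_erase.2 ⟨hab.symm, hb⟩),
      Finset.card_erase_of_mem ha]
    omega
  have hRS : R ⊆ S' := (Finset.erase_subset _ _).trans (Finset.erase_subset _ _)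
  obtain ⟨φ, hφ0, hφ⟩ := exists_dual_ne_zero_of_points {a, b}
    (by rw [Finset.card_pair hab]; omega)
  obtain ⟨ψ, hψ0, hψ⟩ := exists_dual_ne_zero_of_points R (by omega)
  have hker : ∀ χ : Dual ℂ V, χ ≠ 0 → finrank ℂ (LinearMap.ker χ) = 2 := by
    intro χ hχ
    have := Module.Dual.finrank_ker_add_one_of_ne_zero hχ
    omega
  have hL : Submodule.span ℂ {a.rep, b.rep} = LinearMap.ker φ := by
    apply Submodule.eq_of_le_of_finrank_le
    · rw [Submodule.span_le]
      rintro _ (rfl | rfl)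
      · exact hφ a (by simp)
      · exact hφ b (by simp)
    · rw [hker φ hφ0, hthree.finrank_eq]
  rw [hL] at hthree hoff ho
  have hψne : ∀ p ∈ S', p ∉ R → ψ p.rep ≠ 0 := by
    intro p hp hpR h0
    refine hψ0 (hS.dual_eq_zero (F := insert p R) (Finset.insert_subset hp hRS)
      (by rw [Finset.card_insert_of_notMem hpR]; omega) fun x hx => ?_)
    rcases Finset.mem_insert.1 hx with rfl | hx
    · exact h0
    · exact hψ x hx
  have hoffψ : (ptsOff (LinearMap.ker ψ) (insert o S')).card ≤ 3 ∧
      2 ≤ (ptsOff (LinearMap.ker ψ) (insert o S')).card := by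
    constructor
    · refine (Finset.card_le_card (t := {o, a, b}) fun p hp => ?_).trans Finset.card_le_three
      rw [mem_ptsOff, Finset.mem_insert] at hp
      by_contra hne
      simp only [Finset.mem_insert, Finset.mem_singleton, not_or] at hne
      exact hp.2 (hψ p (by
        rw [hR, Finset.mem_erase, Finset.mem_erase]
        exact ⟨hne.2.2, hne.2.1, hp.1.resolve_left hne.1⟩))
    · rw [← Finset.card_pair hab]
      refine Finset.card_le_card fun p hp => ?_
      rw [mem_ptsOff]
      rcases Finset.mem_insert.1 hp with rfl | hp
      · exact ⟨Finset.mem_insert_of_mem ha, hψne p ha (by simp [hR])⟩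
      · rw [Finset.mem_singleton] at hp
        subst hp
        exact ⟨Finset.mem_insert_of_mem hb, hψne p hb (by simp [hR])⟩
  -- The conic `φψ` vanishes on `insert o S'`, hence at every point of `A`, whose square is a
  -- combination of the old squares. So `A` lies on the two lines and has at most five incidences
  -- with their complements.
  have hdic : ∀ (A : Finset (ℙ ℂ V)) (d : ℙ ℂ V → ℂ), A.card = 2 * 2 + 1 →
      QuarticEq A d (insert o S') c →
      ptsOff (LinearMap.ker φ) A = ptsOff (LinearMap.ker φ) (insert o S') ∨
      (ptsOff (LinearMap.ker ψ) A).card = 2 := by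
    intro A d hA h
    have hd := h.coeff_ne_zero hc hind (hA.trans hScard.symm).le
    have hsq := (h.card_le_and_sq hc hind).2 (hA.trans hScard.symm).le
    have hcov : ∀ p ∈ A, φ p.rep * ψ p.rep = 0 := by
      intro p hp
      obtain ⟨x, hx⟩ := hsq p hp
      rw [hx]
      refine Finset.sum_eq_zero fun s hs => ?_
      by_cases hsL : s.rep ∈ LinearMap.ker φ
      · rw [LinearMap.mem_ker.1 hsL]; ring
      · have : s ∈ R := hoff ▸ mem_ptsOff.2 ⟨hs, hsL⟩
        rw [hψ s this]; ring
    have hsum : (ptsOff (LinearMap.ker φ) A).card + (ptsOff (LinearMap.ker ψ) A).card ≤ 5 := by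
      have := card_ptsOn_add_card_ptsOff (LinearMap.ker φ) A
      have h2 : ptsOff (LinearMap.ker ψ) A ⊆ ptsOn (LinearMap.ker φ) A := by
        intro p hp
        rw [mem_ptsOff] at hp
        exact mem_ptsOn.2 ⟨hp.1, (mul_eq_zero.1 (hcov p hp.1)).resolve_right hp.2⟩
      have := Finset.card_le_card h2
      omega
    by_cases h2 : (ptsOff (LinearMap.ker φ) A).card ≤ 2
    · exact Or.inl (h.ptsOff_eq hd hc (by rw [hoff]; omega))
    -- At least three points lie off `φ = 0`, so at most two lie off `ψ = 0`. With fewer than two,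
    -- comparison with the at most three such points of `insert o S'` would make the sets equal,
    -- though the latter has at least two.
    · right
      by_contra hne
      have h3 := h.ptsOff_eq (φ := ψ) hd hc (by omega)
      rw [← h3] at hoffψ
      omega
  -- Exceptional decompositions have two points each off `ψ = 0`, so they all agree there, and any
  -- one of them serves as reference.
  by_cases hex : ∃ (A₀ : Finset (ℙ ℂ V)) (d₀ : ℙ ℂ V → ℂ), A₀.card = 2 * 2 + 1 ∧
      QuarticEq A₀ d₀ (insert o S') c ∧ (ptsOff (LinearMap.ker ψ) A₀).card = 2
  · obtain ⟨A₀, d₀, hA₀, h₀, h₀₂⟩ := hex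
    have hd₀ := h₀.coeff_ne_zero hc hind (hA₀.trans hScard.symm).le
    have hthree₀ : ThreeOn (LinearMap.ker ψ) A₀ d₀ := by
      refine ⟨hker ψ hψ0, hd₀, ?_, ?_⟩
      · have := card_ptsOn_add_card_ptsOff (LinearMap.ker ψ) A₀
        omega
      · intro r hr
        obtain ⟨y, hy⟩ := Finset.card_eq_one.1 (show ((ptsOff (LinearMap.ker ψ) A₀).erase r).card
          = 1 by rw [Finset.card_erase_of_mem hr]; omega)
        obtain ⟨χ, hχr, hχy⟩ := exists_dual_of_ne (p := r) (p' := y) (by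
          rintro rfl
          exact Finset.notMem_erase r _ (hy ▸ Finset.mem_singleton_self r))
        have hψr : ψ r.rep ≠ 0 := (mem_ptsOff.1 hr).2
        refine ⟨ψ, ψ, χ, χ, by simp [hψr, hχr], ?_⟩
        rintro p (hp | ⟨hp, hpr⟩)
        · rw [LinearMap.mem_ker.1 hp]; ring
        · have : p ∈ ({y} : Finset (ℙ ℂ V)) := hy ▸ Finset.mem_erase.2 ⟨hpr, hp⟩
          rw [Finset.mem_singleton.1 this, hχy]; ring
    refine ⟨![LinearMap.ker φ, LinearMap.ker ψ], ![insert o S', A₀], ![c, d₀],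
      Fin.forall_fin_two.2 ⟨hthree, hthree₀⟩,
      Fin.forall_fin_two.2 ⟨hScard, hA₀⟩, Fin.forall_fin_two.2 ⟨hrefl, h₀⟩,
      fun A d hA h => ?_⟩
    rcases hdic A d hA h with h1 | h1
    · exact ⟨0, h1⟩
    · have hd := h.coeff_ne_zero hc hind (hA.trans hScard.symm).le
      exact ⟨1, QuarticEq.ptsOff_eq (c := d₀)
        (fun φ₁ φ₂ φ₃ φ₄ => (h φ₁ φ₂ φ₃ φ₄).trans (h₀ φ₁ φ₂ φ₃ φ₄).symm) hd hd₀ (by omega)⟩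
  · refine ⟨fun _ => _, fun _ => _, fun _ => c, fun _ => hthree, fun _ => hScard, fun _ => hrefl,
      fun A d hA h => ⟨0, (hdic A d hA h).resolve_right fun h2 => hex ⟨A, d, hA, h, h2⟩⟩⟩

end Collinear

/-! ### Coordinates on a line -/

section LineCoordinates

variable {V : Type*} [AddCommGroup V] [Module ℂ V]

/-- Three points of a line, in coordinates in which they are `(1 : 0)`, `(0 : 1)` and `(1 : 1)`. -/
theorem exists_line_coordinates {L : Submodule ℂ V} (hL : finrank ℂ L = 2)
    {a b o : ℙ ℂ V} (ha : a.rep ∈ L) (hb : b.rep ∈ L) (ho : o.rep ∈ L) (hab : a ≠ b)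
    (hao : a ≠ o) (hbo : b ≠ o) :
    ∃ (u v : V) (ξ η : Dual ℂ V) (α β : ℂ), u ∈ L ∧ v ∈ L ∧ ξ u = 1 ∧ ξ v = 0 ∧ η u = 0 ∧ η v = 1 ∧
      (∀ w ∈ L, w = ξ w • u + η w • v) ∧ α ≠ 0 ∧ β ≠ 0 ∧ a.rep = α • u ∧ b.rep = β • v ∧
      o.rep = u + v := by
  classical
  obtain ⟨ξ₀, hξa, hξb⟩ := exists_dual_of_ne hab
  obtain ⟨η₀, hηb, hηa⟩ := exists_dual_of_ne hab.symm
  have hspan : ∀ w ∈ L, ∃ x y : ℂ, w = x • a.rep + y • b.rep := by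
    have hfd : FiniteDimensional ℂ L := FiniteDimensional.of_finrank_pos (by omega)
    have hle : Submodule.span ℂ {a.rep, b.rep} ≤ L := by
      rw [Submodule.span_le]
      rintro _ (rfl | rfl)
      · exact ha
      · exact hb
    have hli : LinearIndependent ℂ ![a.rep, b.rep] := by
      rw [LinearIndependent.pair_iff]
      intro s t hst
      constructor
      · have := congrArg ξ₀ hst
        simpa [hξb, hξa] using this
      · have := congrArg η₀ hst
        simpa [hηb, hηa] using this
    have hrk := finrank_span_eq_card hli
    rw [Matrix.range_cons, Matrix.range_cons, Matrix.range_empty, Set.union_empty,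
      Set.singleton_union, Fintype.card_fin] at hrk
    have heq := Submodule.eq_of_le_of_finrank_le hle (by omega)
    intro w hw
    rw [← heq, Submodule.mem_span_pair] at hw
    obtain ⟨x, y, rfl⟩ := hw
    exact ⟨x, y, rfl⟩
  obtain ⟨x, y, hxy⟩ := hspan _ ho
  have hx : x ≠ 0 := by
    rintro rfl
    exact hbo (eq_of_rep_smul (a := y) (b := 1) (by
      rintro rfl
      exact o.rep_nonzero (by rw [hxy]; simp)) (by rw [hxy]; simp))
  have hy : y ≠ 0 := by
    rintro rfl
    exact hao (eq_of_rep_smul (a := x) (b := 1) hx (by rw [hxy]; simp))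
  refine ⟨x • a.rep, y • b.rep, (x * ξ₀ a.rep)⁻¹ • ξ₀, (y * η₀ b.rep)⁻¹ • η₀, x⁻¹, y⁻¹,
    L.smul_mem _ ha, L.smul_mem _ hb, ?_, ?_, ?_, ?_, ?_, inv_ne_zero hx, inv_ne_zero hy, ?_, ?_,
    hxy⟩
  · simp only [LinearMap.smul_apply, map_smul, smul_eq_mul]
    field_simp
  · simp [hξb]
  · simp [hηa]
  · simp only [LinearMap.smul_apply, map_smul, smul_eq_mul]
    field_simp
  · intro w hw
    obtain ⟨s, t, rfl⟩ := hspan w hw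
    simp only [LinearMap.smul_apply, map_add, map_smul, smul_eq_mul, hξb, hηa, mul_zero, add_zero,
      zero_add, smul_smul]
    congr 2
    · field_simp
    · field_simp
  · rw [inv_smul_smul₀ hx]
  · rw [inv_smul_smul₀ hy]

end LineCoordinates

/-! ### Linear forms, polarization and the pencil of Chow forms -/

section Forms

variable {n : ℕ}

/-- Functionals on linear forms are evaluations at points, so identities between forms can be tested
with functionals. -/
theorem exists_eval_eq_dual (φ : Dual ℂ (Form n 1)) :
    ∃ z : Fin (n + 1) → ℂ, ∀ l : Form n 1,
      MvPolynomial.eval z (l : MvPolynomial (Fin (n + 1)) ℂ) = φ l := by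
  refine ⟨fun i => φ ⟨MvPolynomial.X i, MvPolynomial.isHomogeneous_X ℂ i⟩, ?_⟩
  rintro ⟨l, hl⟩
  have hl' := hl
  rw [MvPolynomial.homogeneousSubmodule_one_eq_span_X] at hl'
  induction hl' using Submodule.span_induction with
  | mem x h =>
    obtain ⟨i, rfl⟩ := h
    simp
  | zero => exact (map_zero _).trans (map_zero φ).symm
  | add x y hx hy ihx ihy =>
    rw [← MvPolynomial.homogeneousSubmodule_one_eq_span_X] at hx hy
    exact (map_add _ _ _).trans (by rw [ihx hx, ihy hy, ← map_add]; rfl)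
  | smul a x hx ih =>
    rw [← MvPolynomial.homogeneousSubmodule_one_eq_span_X] at hx
    exact (MvPolynomial.smul_eval _ _ _).trans (by rw [ih hx, ← smul_eq_mul, ← map_smul]; rfl)

theorem linearIndependent_X :
    LinearIndependent ℂ (MvPolynomial.X : Fin (n + 1) → MvPolynomial (Fin (n + 1)) ℂ) := by
  rw [Fintype.linearIndependent_iff]
  intro g hg i
  have := congrArg (MvPolynomial.eval (Pi.single i 1)) hg
  simpa [MvPolynomial.smul_eval, Pi.single_apply] using this

instance : FiniteDimensional ℂ (Form n 1) := by
  change FiniteDimensional ℂ (MvPolynomial.homogeneousSubmodule (Fin (n + 1)) ℂ 1)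
  rw [MvPolynomial.homogeneousSubmodule_one_eq_span_X]
  exact FiniteDimensional.span_of_finite ℂ (Set.finite_range _)

theorem finrank_form_one : finrank ℂ (Form n 1) = n + 1 := by
  change finrank ℂ (MvPolynomial.homogeneousSubmodule (Fin (n + 1)) ℂ 1) = n + 1
  rw [MvPolynomial.homogeneousSubmodule_one_eq_span_X,
    finrank_span_eq_card linearIndependent_X, Fintype.card_fin]

/-- An equality between combinations of fourth powers of linear forms, polarized. -/
theorem quarticEq_of_sum_eq {A B : Finset (Pn n)} {d c : Pn n → ℂ}
    (h : ∑ p ∈ A, d p • powForm 4 p.rep = ∑ p ∈ B, c p • powForm 4 p.rep) :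
    QuarticEq A d B c := by
  have key : ∀ φ : Dual ℂ (Form n 1), ∑ p ∈ A, d p * φ p.rep ^ 4 = ∑ p ∈ B, c p * φ p.rep ^ 4 := by
    intro φ
    obtain ⟨z, hz⟩ := exists_eval_eq_dual φ
    have h1 := congrArg (fun F : Form n 4 =>
      MvPolynomial.eval z (F : MvPolynomial (Fin (n + 1)) ℂ)) h
    simpa [powForm, hz, MvPolynomial.smul_eval] using h1
  intro φ₁ φ₂ φ₃ φ₄
  -- Polarization over the eight sign choices for `φ₂`, `φ₃`, `φ₄`; the constant is `192 = 8 · 4!`.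
  have pol : ∀ (T : Finset (Pn n)) (w : Pn n → ℂ),
      ∑ p ∈ T, w p * (φ₁ p.rep * φ₂ p.rep * φ₃ p.rep * φ₄ p.rep) = (1 / 192 : ℂ) *
        ((∑ p ∈ T, w p * (φ₁ + φ₂ + φ₃ + φ₄) p.rep ^ 4) -
        (∑ p ∈ T, w p * (φ₁ + φ₂ + φ₃ - φ₄) p.rep ^ 4) -
        (∑ p ∈ T, w p * (φ₁ + φ₂ - φ₃ + φ₄) p.rep ^ 4) +
        (∑ p ∈ T, w p * (φ₁ + φ₂ - φ₃ - φ₄) p.rep ^ 4) -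
        (∑ p ∈ T, w p * (φ₁ - φ₂ + φ₃ + φ₄) p.rep ^ 4) +
        (∑ p ∈ T, w p * (φ₁ - φ₂ + φ₃ - φ₄) p.rep ^ 4) +
        (∑ p ∈ T, w p * (φ₁ - φ₂ - φ₃ + φ₄) p.rep ^ 4) -
        (∑ p ∈ T, w p * (φ₁ - φ₂ - φ₃ - φ₄) p.rep ^ 4)) := by
    intro T w
    simp only [← Finset.sum_sub_distrib, ← Finset.sum_add_distrib]
    rw [Finset.mul_sum]
    refine Finset.sum_congr rfl fun p _ => ?_
    simp only [LinearMap.add_apply, LinearMap.sub_apply]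
    ring
  rw [pol, pol]
  simp only [key]

/-- The products of the linear forms of the decompositions which differ from a given one only at
the points of a line form a pencil. -/
theorem ThreeOn.exists_pencil {L : Submodule ℂ (Form n 1)} {B : Finset (Pn n)} {f : Pn n → ℂ}
    (hB : ThreeOn L B f) (k : ℕ) (hk : B.card = k) :
    ∃ W : Submodule ℂ (Form n k), FiniteDimensional ℂ W ∧ finrank ℂ W ≤ 2 ∧
      ∀ (A : Finset (Pn n)) (d : Pn n → ℂ) (hA : A.card = k), QuarticEq A d B f →
        ptsOff L A = ptsOff L B → prodForm A hA ∈ W := by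
  classical
  obtain ⟨a, b, o, hab, hao, hbo, habo⟩ := Finset.card_eq_three.1 hB.card_eq
  have hmem : ∀ p ∈ ({a, b, o} : Finset (Pn n)), p ∈ B ∧ p.rep ∈ L := fun p hp =>
    mem_ptsOn.1 (habo ▸ hp)
  obtain ⟨u, v, ξ, η, α, β, -, -, hξu, hξv, hηu, hηv, hw, hα, hβ, ha, hb, ho⟩ :=
    exists_line_coordinates hB.finrank_eq (hmem a (by simp)).2 (hmem b (by simp)).2
      (hmem o (by simp)).2 hab hao hbo
  have hfo := hB.coeff_ne o (hmem o (by simp)).1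
  have hfa := hB.coeff_ne a (hmem a (by simp)).1
  set c₁ := f a * α ^ 4 with hc₁
  set c₂ := f b * β ^ 4 with hc₂
  set c₃ := f o with hc₃
  have hc₁0 : c₁ ≠ 0 := mul_ne_zero hfa (pow_ne_zero 4 hα)
  -- `κ`, `G₀` and `G₁` come from solving the apolarity equations `e1` and `e2` for two of the four
  -- coefficients of a cubic.
  set κ : ℂ := -c₂ / c₁ with hκ
  set U : MvPolynomial (Fin (n + 1)) ℂ := u.1 with hU
  set Z : MvPolynomial (Fin (n + 1)) ℂ := v.1 with hZ
  set P : MvPolynomial (Fin (n + 1)) ℂ :=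
    ∏ p ∈ ptsOff L B, (p.rep : MvPolynomial (Fin (n + 1)) ℂ) with hP
  set G₀ : MvPolynomial (Fin (n + 1)) ℂ :=
    (U ^ 3 + (((c₁ + c₃) * κ - c₃) / c₃) • (U * Z ^ 2) + κ • Z ^ 3) * P with hG₀
  set G₁ : MvPolynomial (Fin (n + 1)) ℂ := (U ^ 2 * Z + U * Z ^ 2) * P with hG₁
  set W₀ : Submodule ℂ (MvPolynomial (Fin (n + 1)) ℂ) := Submodule.span ℂ {G₀, G₁} with hW₀
  have hfdW₀ : FiniteDimensional ℂ W₀ := FiniteDimensional.span_of_finite ℂ (Set.toFinite _)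
  have hrkW₀ : finrank ℂ W₀ ≤ 2 := by
    have := finrank_span_finset_le_card (R := ℂ) ({G₀, G₁} : Finset (MvPolynomial (Fin (n + 1)) ℂ))
    rw [Finset.coe_pair] at this
    exact this.trans Finset.card_le_two
  let ι : W₀.comap (MvPolynomial.homogeneousSubmodule (Fin (n + 1)) ℂ k).subtype →ₗ[ℂ] W₀ :=
    (MvPolynomial.homogeneousSubmodule (Fin (n + 1)) ℂ k).subtype.restrict fun x hx => hx
  have hι : Function.Injective ι := by
    intro x y hxy
    have := congrArg Subtype.val hxy
    exact Subtype.ext (Subtype.ext this)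
  refine ⟨_, FiniteDimensional.of_injective ι hι,
    (LinearMap.finrank_le_finrank_of_injective hι).trans hrkW₀, fun A d hA h hoff => ?_⟩
  have hon := h.ptsOn_of_ptsOff_eq hB.sep hoff
  have hcard : (ptsOn L A).card = 3 := by
    have h1 := card_ptsOn_add_card_ptsOff L A
    have h2 := card_ptsOn_add_card_ptsOff L B
    rw [hoff] at h1
    rw [hB.card_eq] at h2
    omega
  obtain ⟨p₁, p₂, p₃, h12, h13, h23, hp⟩ := Finset.card_eq_three.1 hcard
  have hpL : ∀ p ∈ ({p₁, p₂, p₃} : Finset (Pn n)),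
      (p.rep : MvPolynomial (Fin (n + 1)) ℂ) = ξ p.rep • U + η p.rep • Z := by
    intro p hp'
    have := hw p.rep (mem_ptsOn.1 (hp ▸ hp')).2
    exact congrArg Subtype.val this
  have hmom : ∀ φ₁ φ₂ φ₃ φ₄ : Dual ℂ (Form n 1),
      d p₁ * (φ₁ p₁.rep * φ₂ p₁.rep * φ₃ p₁.rep * φ₄ p₁.rep) +
      (d p₂ * (φ₁ p₂.rep * φ₂ p₂.rep * φ₃ p₂.rep * φ₄ p₂.rep) +
      d p₃ * (φ₁ p₃.rep * φ₂ p₃.rep * φ₃ p₃.rep * φ₄ p₃.rep)) =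
      c₁ * (φ₁ u * φ₂ u * φ₃ u * φ₄ u) + c₂ * (φ₁ v * φ₂ v * φ₃ v * φ₄ v) +
      c₃ * (φ₁ (u + v) * φ₂ (u + v) * φ₃ (u + v) * φ₄ (u + v)) := by
    intro φ₁ φ₂ φ₃ φ₄
    have h1 := hon φ₁ φ₂ φ₃ φ₄
    rw [hp, habo, Finset.sum_insert (by simp [h12, h13]), Finset.sum_pair h23,
      Finset.sum_insert (by simp [hab, hao]), Finset.sum_pair hbo] at h1
    rw [h1, ha, hb, ho]
    simp only [map_smul, smul_eq_mul, hc₁, hc₂, hc₃]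
    ring
  -- The five moments of the unknown points are the coefficients, up to binomials, of the binary
  -- quartic `c₁u⁴ + c₂v⁴ + c₃(u + v)⁴`.
  have m0 := hmom ξ ξ ξ ξ
  have m1 := hmom ξ ξ ξ η
  have m2 := hmom ξ ξ η η
  have m3 := hmom ξ η η η
  have m4 := hmom η η η η
  simp only [map_add, hξu, hξv, hηu, hηv, mul_zero, mul_one, add_zero, zero_add] at m0 m1 m2 m3 m4
  have hprod : ((prodForm A hA : Form n k) : MvPolynomial (Fin (n + 1)) ℂ) =
      (ξ p₁.rep • U + η p₁.rep • Z) * ((ξ p₂.rep • U + η p₂.rep • Z) *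
        (ξ p₃.rep • U + η p₃.rep • Z)) * P := by
    have h1 : ((prodForm A hA : Form n k) : MvPolynomial (Fin (n + 1)) ℂ) =
        (∏ p ∈ ptsOn L A, (p.rep : MvPolynomial (Fin (n + 1)) ℂ)) *
        ∏ p ∈ ptsOff L A, (p.rep : MvPolynomial (Fin (n + 1)) ℂ) := by
      have := Finset.prod_filter_mul_prod_filter_not A (fun p : Pn n => p.rep ∈ L)
        fun p => (p.rep : MvPolynomial (Fin (n + 1)) ℂ)
      rw [ptsOn, ptsOff]
      convert this.symm
      rfl
    rw [h1, hoff, hp, Finset.prod_insert (by simp [h12, h13]), Finset.prod_pair h23,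
      hpL p₁ (by simp), hpL p₂ (by simp), hpL p₃ (by simp)]
  generalize ξ p₁.rep = x₁ at *
  generalize ξ p₂.rep = x₂ at *
  generalize ξ p₃.rep = x₃ at *
  generalize η p₁.rep = y₁ at *
  generalize η p₂.rep = y₂ at *
  generalize η p₃.rep = y₃ at *
  -- The cubic with roots `(xᵢ : yᵢ)` is apolar to the quartic, so it annihilates four consecutive
  -- moments: `m0` to `m3` here, `m1` to `m4` in `e2`. Two linear conditions on four coefficients
  -- leave a pencil.
  have e1 : c₃ * (x₁ * x₂ * x₃) - c₃ * (x₁ * x₂ * y₃ + x₁ * y₂ * x₃ + y₁ * x₂ * x₃) +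
      c₃ * (x₁ * y₂ * y₃ + y₁ * x₂ * y₃ + y₁ * y₂ * x₃) - (c₁ + c₃) * (y₁ * y₂ * y₃) = 0 := by
    linear_combination -(x₁ * x₂ * x₃) * m3 +
      (x₁ * x₂ * y₃ + x₁ * y₂ * x₃ + y₁ * x₂ * x₃) * m2 -
      (x₁ * y₂ * y₃ + y₁ * x₂ * y₃ + y₁ * y₂ * x₃) * m1 + (y₁ * y₂ * y₃) * m0
  have e2 : (c₂ + c₃) * (x₁ * x₂ * x₃) - c₃ * (x₁ * x₂ * y₃ + x₁ * y₂ * x₃ + y₁ * x₂ * x₃) +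
      c₃ * (x₁ * y₂ * y₃ + y₁ * x₂ * y₃ + y₁ * y₂ * x₃) - c₃ * (y₁ * y₂ * y₃) = 0 := by
    linear_combination -(x₁ * x₂ * x₃) * m4 +
      (x₁ * x₂ * y₃ + x₁ * y₂ * x₃ + y₁ * x₂ * x₃) * m3 -
      (x₁ * y₂ * y₃ + y₁ * x₂ * y₃ + y₁ * y₂ * x₃) * m2 + (y₁ * y₂ * y₃) * m1
  have f1 : y₁ * y₂ * y₃ = κ * (x₁ * x₂ * x₃) := by
    rw [hκ]
    field_simp
    linear_combination e2 - e1
  have f2 : x₁ * y₂ * y₃ + y₁ * x₂ * y₃ + y₁ * y₂ * x₃ =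
      (x₁ * x₂ * y₃ + x₁ * y₂ * x₃ + y₁ * x₂ * x₃) +
      ((c₁ + c₃) * κ - c₃) / c₃ * (x₁ * x₂ * x₃) := by
    rw [f1] at e1
    field_simp
    linear_combination e1
  rw [Submodule.mem_comap]
  change ((prodForm A hA : Form n k) : MvPolynomial (Fin (n + 1)) ℂ) ∈ W₀
  rw [hprod, hW₀, Submodule.mem_span_pair]
  refine ⟨x₁ * x₂ * x₃, x₁ * x₂ * y₃ + x₁ * y₂ * x₃ + y₁ * x₂ * x₃, ?_⟩
  have f1' := congrArg (MvPolynomial.C (σ := Fin (n + 1))) f1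
  have f2' := congrArg (MvPolynomial.C (σ := Fin (n + 1))) f2
  rw [hG₀, hG₁]
  simp only [MvPolynomial.smul_eq_C_mul, map_mul, map_add] at f1' f2' ⊢
  linear_combination -(Z ^ 3 * P) * f1' - (U * Z ^ 2 * P) * f2'

end Forms

/-! ### Weights and roots for binary cubics -/

/-- Lagrange interpolation at three distinct nodes gives the first three moments. The other two
follow from the linear recurrence with characteristic roots `yᵢ`, which `h1` and `h2` impose on the
prescribed values. -/
theorem exists_weights {y₁ y₂ y₃ c₁ c₂ c₃ : ℂ} (h12 : y₁ ≠ y₂) (h13 : y₁ ≠ y₃) (h23 : y₂ ≠ y₃)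
    (h1 : c₃ * ((y₁ + y₂ + y₃) - (y₁ * y₂ + y₁ * y₃ + y₂ * y₃) - 1) +
      y₁ * y₂ * y₃ * (c₁ + c₃) = 0)
    (h2 : y₁ * y₂ * y₃ * c₁ = -c₂) :
    ∃ d₁ d₂ d₃ : ℂ, d₁ + d₂ + d₃ = c₁ + c₃ ∧ d₁ * y₁ + d₂ * y₂ + d₃ * y₃ = c₃ ∧
      d₁ * y₁ ^ 2 + d₂ * y₂ ^ 2 + d₃ * y₃ ^ 2 = c₃ ∧
      d₁ * y₁ ^ 3 + d₂ * y₂ ^ 3 + d₃ * y₃ ^ 3 = c₃ ∧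
      d₁ * y₁ ^ 4 + d₂ * y₂ ^ 4 + d₃ * y₃ ^ 4 = c₂ + c₃ := by
  have a12 := sub_ne_zero.2 h12
  have a13 := sub_ne_zero.2 h13
  have a23 := sub_ne_zero.2 h23
  obtain ⟨d₁, d₂, d₃, m0, m1, m2⟩ : ∃ d₁ d₂ d₃ : ℂ, d₁ + d₂ + d₃ = c₁ + c₃ ∧
      d₁ * y₁ + d₂ * y₂ + d₃ * y₃ = c₃ ∧ d₁ * y₁ ^ 2 + d₂ * y₂ ^ 2 + d₃ * y₃ ^ 2 = c₃ := by
    refine ⟨(c₃ - (y₂ + y₃) * c₃ + y₂ * y₃ * (c₁ + c₃)) / ((y₁ - y₂) * (y₁ - y₃)),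
      -(c₃ - (y₁ + y₃) * c₃ + y₁ * y₃ * (c₁ + c₃)) / ((y₁ - y₂) * (y₂ - y₃)),
      (c₃ - (y₁ + y₂) * c₃ + y₁ * y₂ * (c₁ + c₃)) / ((y₁ - y₃) * (y₂ - y₃)), ?_, ?_, ?_⟩
    · field_simp
      ring
    · field_simp
      ring
    · field_simp
      ring
  have m3 : d₁ * y₁ ^ 3 + d₂ * y₂ ^ 3 + d₃ * y₃ ^ 3 = c₃ := by
    linear_combination (y₁ + y₂ + y₃) * m2 - (y₁ * y₂ + y₁ * y₃ + y₂ * y₃) * m1 +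
      y₁ * y₂ * y₃ * m0 + h1
  refine ⟨d₁, d₂, d₃, m0, m1, m2, m3, ?_⟩
  linear_combination (y₁ + y₂ + y₃) * m3 - (y₁ * y₂ + y₁ * y₃ + y₂ * y₃) * m2 +
      y₁ * y₂ * y₃ * m1 + h1 - h2

/-- In the family of cubics `Y³ - tY² + (t + μ)Y - κ`, all but finitely many have distinct roots. -/
theorem finite_discr_eq_zero (μ κ : ℂ) :
    {t : ℂ | (⟨1, -t, t + μ, -κ⟩ : Cubic ℂ).discr = 0}.Finite := by
  let D : Polynomial ℂ := .X ^ 4 + (.C (2 * μ - 4 + 4 * (-κ)) * .X ^ 3 +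
    .C (μ ^ 2 - 12 * μ + 18 * κ) * .X ^ 2 + .C (-12 * μ ^ 2 + 18 * μ * κ) * .X +
    .C (-4 * μ ^ 3 - 27 * κ ^ 2))
  have hD : D ≠ 0 := by
    apply Polynomial.Monic.ne_zero
    apply Polynomial.monic_X_pow_add
    compute_degree!
  refine (Polynomial.finite_setOfPred_isRoot hD).subset fun t ht => ?_
  rw [Set.mem_ofPred_eq, Cubic.discr] at ht
  change D.eval t = 0
  simp only [D, Polynomial.eval_add, Polynomial.eval_mul, Polynomial.eval_pow, Polynomial.eval_X,
    Polynomial.eval_C]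
  linear_combination ht

theorem exists_distinct_roots (μ κ t : ℂ) (h : (⟨1, -t, t + μ, -κ⟩ : Cubic ℂ).discr ≠ 0) :
    ∃ y₁ y₂ y₃ : ℂ, y₁ ≠ y₂ ∧ y₁ ≠ y₃ ∧ y₂ ≠ y₃ ∧ y₁ + y₂ + y₃ = t ∧
      y₁ * y₂ + y₁ * y₃ + y₂ * y₃ = t + μ ∧ y₁ * y₂ * y₃ = κ := by
  have ha : (⟨1, -t, t + μ, -κ⟩ : Cubic ℂ).a ≠ 0 := one_ne_zero
  obtain ⟨x, y, z, h3⟩ := (Cubic.splits_iff_roots_eq_three (φ := RingHom.id ℂ) ha).1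
    (IsAlgClosed.splits _)
  obtain ⟨hxy, hxz, hyz⟩ := (Cubic.discr_ne_zero_iff_roots_ne ha h3).1 h
  have e1 := Cubic.b_eq_three_roots ha h3
  have e2 := Cubic.c_eq_three_roots ha h3
  have e3 := Cubic.d_eq_three_roots ha h3
  simp only [RingHom.id_apply, one_mul, neg_inj] at e1 e2 e3
  exact ⟨x, y, z, hxy, hxz, hyz, e1.symm, e2.symm, e3.symm⟩

/-! ### The one-parameter family of decompositions -/

section Family

variable {n : ℕ}

/-- The fourth powers of the linear forms `u + y v` with moments prescribed. -/
theorem sum_pow_four_eq {u v : MvPolynomial (Fin (n + 1)) ℂ} {y₁ y₂ y₃ d₁ d₂ d₃ c₁ c₂ c₃ : ℂ}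
    (m0 : d₁ + d₂ + d₃ = c₁ + c₃) (m1 : d₁ * y₁ + d₂ * y₂ + d₃ * y₃ = c₃)
    (m2 : d₁ * y₁ ^ 2 + d₂ * y₂ ^ 2 + d₃ * y₃ ^ 2 = c₃)
    (m3 : d₁ * y₁ ^ 3 + d₂ * y₂ ^ 3 + d₃ * y₃ ^ 3 = c₃)
    (m4 : d₁ * y₁ ^ 4 + d₂ * y₂ ^ 4 + d₃ * y₃ ^ 4 = c₂ + c₃) :
    d₁ • (u + y₁ • v) ^ 4 + (d₂ • (u + y₂ • v) ^ 4 + d₃ • (u + y₃ • v) ^ 4) =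
      c₁ • u ^ 4 + (c₂ • v ^ 4 + c₃ • (u + v) ^ 4) := by
  have n0 := congrArg (MvPolynomial.C (σ := Fin (n + 1))) m0
  have n1 := congrArg (MvPolynomial.C (σ := Fin (n + 1))) m1
  have n2 := congrArg (MvPolynomial.C (σ := Fin (n + 1))) m2
  have n3 := congrArg (MvPolynomial.C (σ := Fin (n + 1))) m3
  have n4 := congrArg (MvPolynomial.C (σ := Fin (n + 1))) m4
  simp only [MvPolynomial.smul_eq_C_mul, map_mul, map_add, map_pow] at n0 n1 n2 n3 n4 ⊢
  linear_combination u ^ 4 * n0 + 4 * u ^ 3 * v * n1 + 6 * u ^ 2 * v ^ 2 * n2 +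
    4 * u * v ^ 3 * n3 + v ^ 4 * n4

/-- Converse to `ThreeOn.exists_pencil`: the pencil is parametrized by `t`, and each member with
distinct roots gives three points of the line that replace those of `B`. Only finitely many `t` have
vanishing discriminant. -/
theorem ThreeOn.infinite_chowPoint {L : Submodule ℂ (Form n 1)} {B : Finset (Pn n)}
    {f : Pn n → ℂ} (hB : ThreeOn L B f) (k : ℕ) (hk : B.card = k) :
    {P : ℙ ℂ (Form n k) | ∃ (A : Finset (Pn n)) (hA : A.card = k) (d : Pn n → ℂ),
      ∑ p ∈ A, d p • powForm 4 p.rep = ∑ p ∈ B, f p • powForm 4 p.rep ∧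
      P = chowPoint A hA}.Infinite := by
  classical
  obtain ⟨a, b, o, hab, hao, hbo, habo⟩ := Finset.card_eq_three.1 hB.card_eq
  have hmem : ∀ p ∈ ({a, b, o} : Finset (Pn n)), p ∈ B ∧ p.rep ∈ L := fun p hp =>
    mem_ptsOn.1 (habo ▸ hp)
  obtain ⟨u, v, ξ, η, α, β, hu, hv, hξu, hξv, hηu, hηv, -, hα, hβ, ha, hb, ho⟩ :=
    exists_line_coordinates hB.finrank_eq (hmem a (by simp)).2 (hmem b (by simp)).2
      (hmem o (by simp)).2 hab hao hbo
  have hfo := hB.coeff_ne o (hmem o (by simp)).1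
  have hfa := hB.coeff_ne a (hmem a (by simp)).1
  set c₁ := f a * α ^ 4 with hc₁
  set c₂ := f b * β ^ 4 with hc₂
  set c₃ := f o with hc₃
  have hc₁0 : c₁ ≠ 0 := mul_ne_zero hfa (pow_ne_zero 4 hα)
  set κ : ℂ := -c₂ / c₁ with hκ
  set μ : ℂ := ((c₁ + c₃) * κ - c₃) / c₃ with hμ
  set U : MvPolynomial (Fin (n + 1)) ℂ := u.1 with hU
  set Z : MvPolynomial (Fin (n + 1)) ℂ := v.1 with hZ
  set P : MvPolynomial (Fin (n + 1)) ℂ :=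
    ∏ p ∈ ptsOff L B, (p.rep : MvPolynomial (Fin (n + 1)) ℂ) with hP
  have hP0 : P ≠ 0 := Finset.prod_ne_zero_iff.2 fun p _ h => p.rep_nonzero (Subtype.ext h)
  have family : ∀ t : ℂ, (⟨1, -t, t + μ, -κ⟩ : Cubic ℂ).discr ≠ 0 →
      ∃ (A : Finset (Pn n)) (hA : A.card = k) (d : Pn n → ℂ) (γ : ℂ),
        ∑ p ∈ A, d p • powForm 4 p.rep = ∑ p ∈ B, f p • powForm 4 p.rep ∧ γ ≠ 0 ∧
        ((prodForm A hA : Form n k) : MvPolynomial (Fin (n + 1)) ℂ) =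
          γ • ((U ^ 3 + t • (U ^ 2 * Z) + (t + μ) • (U * Z ^ 2) + κ • Z ^ 3) * P) := by
    intro t ht
    obtain ⟨y₁, y₂, y₃, h12, h13, h23, e1, e2, e3⟩ := exists_distinct_roots μ κ t ht
    obtain ⟨d₁, d₂, d₃, m0, m1, m2, m3, m4⟩ := exists_weights (c₁ := c₁) (c₂ := c₂) (c₃ := c₃)
      h12 h13 h23 (by
        rw [e1, e2, e3, hμ]
        field_simp
        ring) (by
        rw [e3, hκ]
        field_simp)
    have hne : ∀ y : ℂ, u + y • v ≠ 0 := by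
      intro y h
      have := congrArg ξ h
      simp [hξu, hξv] at this
    let pt : ℂ → Pn n := fun y => Projectivization.mk ℂ (u + y • v) (hne y)
    have hpt : ∀ y, ∃ g : ℂ, g ≠ 0 ∧ (pt y).rep = g • (u + y • v) := by
      intro y
      obtain ⟨g, hg⟩ := Projectivization.exists_smul_eq_mk_rep ℂ (u + y • v) (hne y)
      exact ⟨g, g.ne_zero, hg.symm⟩
    choose g hg0 hg using hpt
    have hptinj : ∀ {y y' : ℂ}, y ≠ y' → pt y ≠ pt y' := by
      intro y y' hyy h
      obtain ⟨s, hs⟩ := (Projectivization.mk_eq_mk_iff' ℂ _ _ _ _).1 h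
      have h1 := congrArg ξ hs
      have h2 := congrArg η hs
      simp [hξu, hξv] at h1
      simp [hηu, hηv, h1] at h2
      exact hyy h2.symm
    have hptL : ∀ y, (pt y).rep ∈ L := fun y => by
      rw [hg]
      exact L.smul_mem _ (L.add_mem hu (L.smul_mem _ hv))
    set N : Finset (Pn n) := {pt y₁, pt y₂, pt y₃} with hN
    have hNL : ∀ p ∈ N, p.rep ∈ L := by
      intro p hp
      simp only [hN, Finset.mem_insert, Finset.mem_singleton] at hp
      rcases hp with rfl | rfl | rfl <;> exact hptL _
    have hdisj : Disjoint N (ptsOff L B) :=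
      Finset.disjoint_left.2 fun p hp hp' => (mem_ptsOff.1 hp').2 (hNL p hp)
    have hNcard : N.card = 3 :=
      Finset.card_eq_three.2 ⟨_, _, _, hptinj h12, hptinj h13, hptinj h23, rfl⟩
    have hsumN : ∀ {M : Type} [AddCommMonoid M] (F : Pn n → M),
        ∑ p ∈ N, F p = F (pt y₁) + (F (pt y₂) + F (pt y₃)) := by
      intro M _ F
      rw [hN, Finset.sum_insert (by simp [hptinj h12, hptinj h13]), Finset.sum_pair (hptinj h23)]
    have hprodN : ∀ F : Pn n → MvPolynomial (Fin (n + 1)) ℂ,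
        ∏ p ∈ N, F p = F (pt y₁) * (F (pt y₂) * F (pt y₃)) := by
      intro F
      rw [hN, Finset.prod_insert (by simp [hptinj h12, hptinj h13]),
        Finset.prod_pair (hptinj h23)]
    have hA : (N ∪ ptsOff L B).card = k := by
      have := card_ptsOn_add_card_ptsOff L B
      rw [Finset.card_union_of_disjoint hdisj, hNcard]
      rw [hB.card_eq] at this
      omega
    -- The factors `(g y ^ 4)⁻¹` compensate for the representative of `pt y` being `g y • (u + y •
    -- v)`.
    let d : Pn n → ℂ := fun p =>
      if p = pt y₁ then d₁ * (g y₁ ^ 4)⁻¹ else if p = pt y₂ then d₂ * (g y₂ ^ 4)⁻¹ else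
        if p = pt y₃ then d₃ * (g y₃ ^ 4)⁻¹ else f p
    have hd1 : d (pt y₁) = d₁ * (g y₁ ^ 4)⁻¹ := if_pos rfl
    have hd2 : d (pt y₂) = d₂ * (g y₂ ^ 4)⁻¹ := by
      simp only [d, if_neg (hptinj h12).symm, if_pos]
    have hd3 : d (pt y₃) = d₃ * (g y₃ ^ 4)⁻¹ := by
      simp only [d, if_neg (hptinj h13).symm, if_neg (hptinj h23).symm, if_pos]
    have hdoff : ∀ p ∈ ptsOff L B, d p = f p := by
      intro p hp
      have hpN : p ∉ N := fun h => Finset.disjoint_left.1 hdisj h hp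
      simp only [hN, Finset.mem_insert, Finset.mem_singleton, not_or] at hpN
      simp only [d, if_neg hpN.1, if_neg hpN.2.1, if_neg hpN.2.2]
    have hrep : ∀ y, ((pt y).rep : MvPolynomial (Fin (n + 1)) ℂ) = g y • (U + y • Z) := fun y =>
      congrArg Subtype.val (hg y)
    refine ⟨N ∪ ptsOff L B, hA, d, g y₁ * (g y₂ * g y₃), ?_,
      mul_ne_zero (hg0 _) (mul_ne_zero (hg0 _) (hg0 _)), ?_⟩
    · rw [Finset.sum_union hdisj, ← sum_ptsOn_add_sum_ptsOff L B,
        Finset.sum_congr (s₁ := ptsOff L B) rfl fun p hp => by rw [hdoff p hp]]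
      congr 1
      rw [hsumN, habo, Finset.sum_insert (by simp [hab, hao]), Finset.sum_pair hbo]
      apply Subtype.ext
      have hcancel : ∀ (y e : ℂ), (e * (g y ^ 4)⁻¹) • (g y • (U + y • Z)) ^ 4 =
          e • (U + y • Z) ^ 4 := by
        intro y e
        rw [smul_pow, smul_smul, inv_mul_cancel_right₀ (pow_ne_zero 4 (hg0 y))]
      have hra : (a.rep : MvPolynomial (Fin (n + 1)) ℂ) = α • U := congrArg Subtype.val ha
      have hrb : (b.rep : MvPolynomial (Fin (n + 1)) ℂ) = β • Z := congrArg Subtype.val hb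
      have hro : (o.rep : MvPolynomial (Fin (n + 1)) ℂ) = U + Z := congrArg Subtype.val ho
      have hmain := sum_pow_four_eq (u := U) (v := Z) m0 m1 m2 m3 m4
      simp only [powForm, Submodule.coe_add, Submodule.coe_smul, hrep, hd1, hd2, hd3, hcancel,
        hra, hrb, hro]
      rw [hmain, smul_pow, smul_pow, smul_smul, smul_smul]
    · change ∏ p ∈ N ∪ ptsOff L B, (p.rep : MvPolynomial (Fin (n + 1)) ℂ) = _
      rw [Finset.prod_union hdisj, hprodN, hrep, hrep, hrep]
      have f1 := congrArg (MvPolynomial.C (σ := Fin (n + 1))) e1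
      have f2 := congrArg (MvPolynomial.C (σ := Fin (n + 1))) e2
      have f3 := congrArg (MvPolynomial.C (σ := Fin (n + 1))) e3
      simp only [MvPolynomial.smul_eq_C_mul, map_mul, map_add] at f1 f2 f3 ⊢
      linear_combination (MvPolynomial.C (g y₁) * (MvPolynomial.C (g y₂) *
        MvPolynomial.C (g y₃)) * P) * (U ^ 2 * Z * f1 + U * Z ^ 2 * f2 + Z ^ 3 * f3)
  choose! A hA d γ hsum hγ hprod using family
  have hinf : {t : ℂ | (⟨1, -t, t + μ, -κ⟩ : Cubic ℂ).discr ≠ 0}.Infinite :=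
    (finite_discr_eq_zero μ κ).infinite_compl
  refine Set.infinite_of_injOn_mapsTo
    (f := fun t => if h : (⟨1, -t, t + μ, -κ⟩ : Cubic ℂ).discr ≠ 0 then chowPoint (A t) (hA t h)
      else chowPoint B hk) (s := {t : ℂ | (⟨1, -t, t + μ, -κ⟩ : Cubic ℂ).discr ≠ 0}) ?_ ?_ hinf
  · intro t ht t' ht' h
    rw [Set.mem_ofPred_eq] at ht ht'
    simp only [dif_pos ht, dif_pos ht'] at h
    obtain ⟨s, hs⟩ := (Projectivization.mk_eq_mk_iff' ℂ _ _ _ _).1 h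
    have hs' : s • ((prodForm (A t') (hA t' ht') : Form n k) : MvPolynomial (Fin (n + 1)) ℂ) =
      ((prodForm (A t) (hA t ht) : Form n k) : MvPolynomial (Fin (n + 1)) ℂ) :=
      congrArg Subtype.val hs
    rw [hprod t' ht', hprod t ht, smul_smul, ← smul_mul_assoc (s * γ t'),
      ← smul_mul_assoc (γ t)] at hs'
    have hs'' := mul_right_cancel₀ hP0 hs'
    -- At `(U, Z) = (1, 0)` the cubics take the value 1, so the scalars agree; at `(1, 1)` they take
    -- the value `1 + 2t + μ + κ`, which recovers `t`.
    obtain ⟨z₁, hz₁⟩ := exists_eval_eq_dual ξ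
    obtain ⟨z₂, hz₂⟩ := exists_eval_eq_dual (ξ + η)
    have hu1 : MvPolynomial.eval z₁ U = 1 := (hz₁ u).trans hξu
    have hv1 : MvPolynomial.eval z₁ Z = 0 := (hz₁ v).trans hξv
    have hu2 : MvPolynomial.eval z₂ U = 1 := (hz₂ u).trans (by simp [hξu, hηu])
    have hv2 : MvPolynomial.eval z₂ Z = 1 := (hz₂ v).trans (by simp [hξv, hηv])
    have q1 := congrArg (MvPolynomial.eval z₁) hs''
    have q2 := congrArg (MvPolynomial.eval z₂) hs''
    simp only [MvPolynomial.smul_eval, map_add, map_mul, map_pow, hu1, hv1, hu2, hv2] at q1 q2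
    have q3 : s * γ t' = γ t := by linear_combination q1
    rw [q3] at q2
    have q4 := mul_left_cancel₀ (hγ t ht) q2
    linear_combination (1 / 2 : ℂ) * -q4
  · intro t ht
    rw [Set.mem_ofPred_eq] at ht
    simp only [dif_pos ht]
    exact ⟨A t, hA t ht, d t, hsum t ht, rfl⟩

end Family

/-! ### Krull dimension of infinite subsets of a union of lines -/

/-- An irreducible closed set lies in some `C i`; if finite it is a point, if infinite it equals `C
i`. So chains have length at most one. Some `C i` is infinite, hence irreducible, and a point in it
gives a chain of length one. -/
theorem topologicalKrullDim_eq_one_of_cover {X : Type*} [TopologicalSpace X] [T1Space X]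
    [Infinite X] {ι : Type*} [Finite ι] (C : ι → Set X) (hC : ∀ i, IsClosed (C i))
    (hcov : ∀ x, ∃ i, x ∈ C i)
    (hfin : ∀ i (Z : Set X), IsClosed Z → C i ⊆ Z ∨ (C i ∩ Z).Finite) :
    topologicalKrullDim X = 1 := by
  classical
  have hmem : ∀ Z : TopologicalSpace.IrreducibleCloseds X, ∃ i, (Z : Set X) ⊆ C i := by
    intro Z
    have hfinr : (Set.range C).Finite := Set.finite_range C
    obtain ⟨z, hz, hZz⟩ := isIrreducible_iff_sUnion_isClosed.1 Z.isIrreducible hfinr.toFinset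
      (by
        intro z hz
        obtain ⟨i, rfl⟩ := hfinr.mem_toFinset.1 hz
        exact hC i) (by
        intro x _
        obtain ⟨i, hi⟩ := hcov x
        exact ⟨C i, by simp, hi⟩)
    obtain ⟨i, rfl⟩ := hfinr.mem_toFinset.1 hz
    exact ⟨i, hZz⟩
  have heq : ∀ Z : TopologicalSpace.IrreducibleCloseds X, (Z : Set X).Infinite →
      ∀ i, (Z : Set X) ⊆ C i → (Z : Set X) = C i := by
    intro Z hZ i hi
    rcases hfin i Z Z.isClosed with h | h
    · exact hi.antisymm h
    · rw [Set.inter_eq_right.2 hi] at h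
      exact absurd h hZ
  apply le_antisymm
  · rw [topologicalKrullDim, Order.krullDim_le_one_iff]
    intro Z
    by_cases hZ : (Z : Set X).Finite
    · left
      intro Y hYZ
      have hsub : (Z : Set X).Subsingleton := by
        obtain ⟨z, hz, hZz⟩ := isIrreducible_iff_sUnion_isClosed.1 Z.isIrreducible
          (hZ.toFinset.image fun x => {x}) (by
            intro z hz
            obtain ⟨x, -, rfl⟩ := Finset.mem_image.1 hz
            exact isClosed_singleton) (by
            intro x hx
            exact ⟨{x}, by simpa using hx, rfl⟩)
        obtain ⟨x, -, rfl⟩ := Finset.mem_image.1 hz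
        exact Set.subsingleton_singleton.anti hZz
      obtain ⟨y, hy⟩ := Y.isIrreducible.nonempty
      intro z hz
      have hyZ : y ∈ (Z : Set X) := hYZ hy
      rwa [hsub hz hyZ]
    · right
      intro Y hZY
      obtain ⟨i, hi⟩ := hmem Y
      have hZi := heq Z hZ i (fun z hz => hi (hZY hz))
      intro y hy
      change y ∈ (Z : Set X)
      rw [hZi]
      exact hi hy
  · rw [topologicalKrullDim, Order.one_le_krullDim_iff]
    obtain ⟨i, hi⟩ : ∃ i, (C i).Infinite := by
      by_contra! h
      have h1 : (⋃ i, C i).Finite := Set.finite_iUnion h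
      rw [Set.eq_univ_of_forall (fun x => Set.mem_iUnion.2 (hcov x))] at h1
      exact Set.infinite_univ h1
    have hirr : IsIrreducible (C i) := by
      refine ⟨hi.nonempty, isPreirreducible_iff_isClosed_union_isClosed.2
        fun z₁ z₂ h₁ h₂ hz => ?_⟩
      rcases hfin i z₁ h₁ with h | h
      · exact Or.inl h
      rcases hfin i z₂ h₂ with h' | h'
      · exact Or.inr h'
      exfalso
      apply hi
      refine (h.union h').subset fun x hx => ?_
      rcases hz hx with h1 | h1
      · exact Or.inl ⟨hx, h1⟩
      · exact Or.inr ⟨hx, h1⟩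
    obtain ⟨x, hx⟩ := hi.nonempty
    refine ⟨⟨{x}, isIrreducible_singleton, isClosed_singleton⟩, ⟨C i, hirr, hC i⟩, ?_⟩
    refine lt_of_le_of_ne ?_ ?_
    · intro y hy
      have : y = x := hy
      exact this ▸ hx
    · intro h
      have : ({x} : Set X) = C i := congrArg (fun Z : TopologicalSpace.IrreducibleCloseds X =>
        (Z : Set X)) h
      exact hi (this ▸ Set.finite_singleton x)

/-! ### Lines in the Zariski topology -/

section Zariski

variable {V : Type*} [AddCommGroup V] [Module ℂ V]

theorem isClosed_zariski_iff {Z : Set (ℙ ℂ V)} :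
    @IsClosed _ (zariskiTopology V) Z ↔ IsAlgebraicSet Z := by
  rw [← @isOpen_compl_iff _ _ (zariskiTopology V)]
  change IsAlgebraicSet Zᶜᶜ ↔ IsAlgebraicSet Z
  rw [compl_compl]

theorem isAlgebraicSet_subspace (W : Submodule ℂ V) :
    IsAlgebraicSet {p : ℙ ℂ V | p.rep ∈ W} := by
  refine ⟨{F | ∃ φ : Dual ℂ V, (∀ w ∈ W, φ w = 0) ∧ F = MvPolynomial.X φ}, ?_, ?_⟩
  · rintro _ ⟨φ, -, rfl⟩
    exact ⟨1, MvPolynomial.isHomogeneous_X ℂ φ⟩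
  · ext p
    constructor
    · rintro hp _ ⟨φ, hφ, rfl⟩
      simpa [evalAt] using hφ _ hp
    · intro hp
      by_contra hpW
      obtain ⟨φ, h1, h2⟩ := exists_dual_of_notMem hpW
      exact h1 (by simpa [evalAt] using hp _ ⟨φ, h2, rfl⟩)

theorem evalAt_smul {F : MvPolynomial (Dual ℂ V) ℂ} {m : ℕ} (hF : F.IsHomogeneous m) (a : ℂ)
    (v : V) : evalAt F (a • v) = a ^ m * evalAt F v := by
  rw [evalAt, evalAt, MvPolynomial.eval_eq, MvPolynomial.eval_eq, Finset.mul_sum]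
  refine Finset.sum_congr rfl fun d hd => ?_
  have hdeg : ∑ i ∈ d.support, d i = m := by
    have h : Finsupp.weight (fun _ => 1) d = m := hF (MvPolynomial.mem_support_iff.1 hd)
    rw [← Finsupp.degree_eq_weight_one] at h
    exact h
  simp only [map_smul, smul_eq_mul, mul_pow, Finset.prod_mul_distrib]
  rw [Finset.prod_pow_eq_pow_sum, hdeg]
  ring

/-- A closed set contains a line or meets it in finitely many points. -/
theorem subset_or_finite_of_isAlgebraicSet {W : Submodule ℂ V} [FiniteDimensional ℂ W]
    (hW : finrank ℂ W ≤ 2) {Z : Set (ℙ ℂ V)} (hZ : IsAlgebraicSet Z) :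
    {p : ℙ ℂ V | p.rep ∈ W} ⊆ Z ∨ ({p : ℙ ℂ V | p.rep ∈ W} ∩ Z).Finite := by
  obtain ⟨I, hI, rfl⟩ := hZ
  by_cases hsub : {p : ℙ ℂ V | p.rep ∈ W} ⊆ zeroLocus I
  · exact Or.inl hsub
  right
  obtain ⟨p₀, hp₀W, hp₀⟩ := Set.not_subset.1 hsub
  rw [zeroLocus, Set.mem_ofPred_eq] at hp₀
  push Not at hp₀
  obtain ⟨F, hFI, hF⟩ := hp₀
  obtain ⟨m, hFm⟩ := hI F hFI
  obtain ⟨w, hw⟩ : ∃ w : V, ∀ x ∈ W, ∃ s t : ℂ, x = s • p₀.rep + t • w := by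
    have h0 : (⟨p₀.rep, hp₀W⟩ : W) ≠ 0 := fun h => p₀.rep_nonzero (congrArg Subtype.val h)
    by_cases hle : Submodule.span ℂ {p₀.rep} = W
    · refine ⟨0, fun x hx => ?_⟩
      rw [← hle, Submodule.mem_span_singleton] at hx
      obtain ⟨s, rfl⟩ := hx
      exact ⟨s, 0, by simp⟩
    · have hlt : Submodule.span ℂ {p₀.rep} < W :=
        lt_of_le_of_ne ((Submodule.span_singleton_le_iff_mem _ _).2 hp₀W) hle
      obtain ⟨w, hwW, hw⟩ := SetLike.exists_of_lt hlt
      refine ⟨w, fun x hx => ?_⟩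
      have hli : LinearIndependent ℂ ![p₀.rep, w] := by
        rw [LinearIndependent.pair_iff' p₀.rep_nonzero]
        exact fun a ha => hw (ha ▸ Submodule.smul_mem _ _ (Submodule.mem_span_singleton_self _))
      have hrk := finrank_span_eq_card hli
      rw [Matrix.range_cons, Matrix.range_cons, Matrix.range_empty, Set.union_empty,
        Set.singleton_union, Fintype.card_fin] at hrk
      have heq := Submodule.eq_of_le_of_finrank_le (S₁ := Submodule.span ℂ {p₀.rep, w}) (S₂ := W)
        (by
          rw [Submodule.span_le]
          rintro _ (rfl | rfl)
          · exact hp₀W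
          · exact hwW) (by omega)
      rw [← heq, Submodule.mem_span_pair] at hx
      obtain ⟨s, t, rfl⟩ := hx
      exact ⟨s, t, rfl⟩
  -- `G` is `F` on the affine chart `p₀ + t w` of the line. Since `G(0) = F(p₀) ≠ 0`, it has
  -- finitely many roots; at most one point, that of `w`, lies outside the chart.
  let G : Polynomial ℂ := MvPolynomial.aeval
    (fun φ : Dual ℂ V => Polynomial.C (φ p₀.rep) + Polynomial.X * Polynomial.C (φ w)) F
  have hG : ∀ t : ℂ, G.eval t = evalAt F (p₀.rep + t • w) := by
    intro t
    have := MvPolynomial.comp_aeval_apply (R := ℂ)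
      (fun φ : Dual ℂ V => Polynomial.C (φ p₀.rep) + Polynomial.X * Polynomial.C (φ w))
      (Polynomial.aeval t : Polynomial ℂ →ₐ[ℂ] ℂ) F
    rw [Polynomial.coe_aeval_eq_eval] at this
    rw [this, evalAt, MvPolynomial.aeval_eq_eval]
    congr 2
    ext φ
    simpa using mul_comm _ _
  have hG0 : G ≠ 0 := by
    intro h
    have := hG 0
    rw [h, Polynomial.eval_zero, zero_smul, add_zero] at this
    exact hF this.symm
  have hroots := Polynomial.finite_setOfPred_isRoot hG0
  have hpts : ∀ v : V, {p : ℙ ℂ V | ∃ a : ℂ, p.rep = a • v}.Subsingleton := by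
    rintro v p ⟨a, ha⟩ p' ⟨a', ha'⟩
    have ha0 : a ≠ 0 := by
      rintro rfl
      exact p.rep_nonzero (by simpa using ha)
    have ha0' : a' ≠ 0 := by
      rintro rfl
      exact p'.rep_nonzero (by simpa using ha')
    exact eq_of_rep_smul (a := a') (b := a) ha0' (by rw [ha, ha', smul_smul, smul_smul, mul_comm])
  refine ((hroots.biUnion fun t _ => (hpts (p₀.rep + t • w)).finite).union
    (hpts w).finite).subset ?_
  rintro p ⟨hpW, hpZ⟩
  obtain ⟨s, t, hst⟩ := hw p.rep hpW
  by_cases hs : s = 0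
  · right
    exact ⟨t, by rw [hst, hs, zero_smul, zero_add]⟩
  · left
    have hrep : p.rep = s • (p₀.rep + (s⁻¹ * t) • w) := by
      rw [hst, smul_add, smul_smul, mul_inv_cancel_left₀ hs]
    refine Set.mem_biUnion (x := s⁻¹ * t) ?_ ⟨s, hrep⟩
    have h1 := hpZ F hFI
    rw [hrep, evalAt_smul hFm, ← hG] at h1
    exact (mul_eq_zero.1 h1).resolve_left (pow_ne_zero m hs)

/-- An infinite subset of a finite union of lines has dimension one. -/
theorem zariskiDim_eq_one {T : Set (ℙ ℂ V)} (hT : T.Infinite) {ι : Type*} [Finite ι]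
    (W : ι → Submodule ℂ V) (hfd : ∀ i, FiniteDimensional ℂ (W i)) (hW : ∀ i, finrank ℂ (W i) ≤ 2)
    (hTW : ∀ p ∈ T, ∃ i, p.rep ∈ W i) : zariskiDim T = 1 := by
  let _ : TopologicalSpace (ℙ ℂ V) := zariskiTopology V
  have hT1 : T1Space (ℙ ℂ V) := by
    refine ⟨fun p => (isClosed_zariski_iff (V := V)).2 ?_⟩
    have h := isAlgebraicSet_subspace (Submodule.span ℂ {p.rep})
    convert h
    ext p'
    rw [Set.mem_singleton_iff, Set.mem_ofPred_eq, Submodule.mem_span_singleton]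
    constructor
    · rintro rfl
      exact ⟨1, one_smul _ _⟩
    · rintro ⟨a, ha⟩
      exact eq_of_rep_smul one_ne_zero (by rw [one_smul, ha])
  have hinf : Infinite T := hT.to_subtype
  change topologicalKrullDim T = 1
  refine topologicalKrullDim_eq_one_of_cover
    (fun i => (Subtype.val : T → ℙ ℂ V) ⁻¹' {p | p.rep ∈ W i}) (fun i => ?_) (fun x => ?_) ?_
  · exact (isClosed_zariski_iff.2 (isAlgebraicSet_subspace (W i))).preimage continuous_subtype_val
  · exact hTW x x.2
  · intro i Z hZ
    obtain ⟨Y, hY, rfl⟩ := isClosed_induced_iff.1 hZ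
    have := hfd i
    rcases subset_or_finite_of_isAlgebraicSet (hW i) (isClosed_zariski_iff.1 hY) with h | h
    · exact Or.inl (Set.preimage_mono h)
    · right
      rw [← Set.preimage_inter]
      exact h.preimage Subtype.val_injective.injOn

end Zariski

/-! ### Dimension and linearly general position -/

theorem ncard_lt_two_of_projDim_eq_zero {V : Type*} [AddCommGroup V] [Module ℂ V]
    [FiniteDimensional ℂ V] {N : Projectivization.Subspace ℂ V} (hN : projDim N = 0)
    (S : Finset (ℙ ℂ V)) : ((N : Set (ℙ ℂ V)) ∩ (S : Set (ℙ ℂ V))).ncard < 2 := by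
  obtain ⟨M, hM⟩ : ∃ M : Submodule ℂ (V), M = Projectivization.Subspace.submodule N :=
    ⟨_, rfl⟩
  rw [projDim, sub_eq_zero, ← hM] at hN
  obtain ⟨v, hv⟩ := finrank_le_one_iff.1 (show finrank ℂ M ≤ 1 by exact_mod_cast hN.le)
  by_contra! h
  obtain ⟨p, p', hp, hp', hne⟩ := (Set.one_lt_ncard_iff
    (S.finite_toSet.subset Set.inter_subset_right)).1 h
  obtain ⟨s, hs⟩ := hv ⟨p.rep, hM ▸ (mem_subspace_iff_rep N p).1 hp.1⟩
  obtain ⟨s', hs'⟩ := hv ⟨p'.rep, hM ▸ (mem_subspace_iff_rep N p').1 hp'.1⟩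
  have e1 : s • (v : V) = p.rep := congrArg Subtype.val hs
  have e2 : s' • (v : V) = p'.rep := congrArg Subtype.val hs'
  have hs0 : s' ≠ 0 := by
    rintro rfl
    exact p'.rep_nonzero (by rw [← e2, zero_smul])
  exact hne (eq_of_rep_smul (a := s') (b := s) hs0
    (by rw [← e1, ← e2, smul_smul, smul_smul, mul_comm]))

section Position

variable {n : ℕ}

theorem genPos_of_LGP {A : Finset (Pn n)} (h : LGP A) : GenPos A := by
  intro F hF hc
  rw [finrank_form_one] at hc
  have h1 := h F hF
  rw [projDim, submodule_linSpan] at h1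
  have h2 : finrank ℂ (Submodule.span ℂ (Projectivization.rep '' (F : Set (Pn n)))) = F.card := by
    omega
  rw [LinearIndepOn, linearIndependent_iff_card_eq_finrank_span, Set.finrank]
  rw [Set.image_eq_range] at h2
  exact (Fintype.card_coe F).trans h2.symm

theorem GenPos.finrank_span_image {A F : Finset (Pn n)} (h : GenPos A) (hF : F ⊆ A)
    (hc : F.card ≤ n + 1) :
    finrank ℂ (Submodule.span ℂ (Projectivization.rep '' (F : Set (Pn n)))) = F.card := by
  have h1 := h F hF (by rwa [finrank_form_one])
  rw [LinearIndepOn, linearIndependent_iff_card_eq_finrank_span, Set.finrank] at h1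
  rw [Set.image_eq_range, ← Fintype.card_coe F]
  exact h1.symm

theorem LGP_of_genPos {A : Finset (Pn n)} (h : GenPos A) : LGP A := by
  intro F hF
  rw [projDim, submodule_linSpan]
  by_cases hc : F.card ≤ n + 1
  · rw [h.finrank_span_image hF hc]
    omega
  · rw [h.span_eq_top hF (by rw [finrank_form_one]; omega), finrank_top, finrank_form_one]
    push_cast
    omega

/-- A dependent subset with at most `n + 1` points must contain `o`, as `A` is in general position;
its other points, at most `n`, span `o`. -/
theorem exists_mem_span_of_not_LGP [DecidableEq (Pn n)] {A : Finset (Pn n)} {o : Pn n}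
    (hA : GenPos A) (h : ¬ LGP (insert o A)) :
    ∃ T ⊆ A, T.card ≤ n ∧
      o.rep ∈ Submodule.span ℂ (Projectivization.rep '' (T : Set (Pn n))) := by
  by_contra! hT
  refine h (LGP_of_genPos fun F hF hc => ?_)
  rw [finrank_form_one] at hc
  by_cases hoF : o ∈ F
  · have hsub : F.erase o ⊆ A := by
      intro p hp
      rw [Finset.mem_erase] at hp
      exact (Finset.mem_insert.1 (hF hp.2)).resolve_left hp.1
    have hcard : (F.erase o).card ≤ n := by
      rw [Finset.card_erase_of_mem hoF]
      omega
    rw [← Finset.insert_erase hoF, Finset.coe_insert, linearIndepOn_insert (by simp)]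
    exact ⟨hA _ hsub (by rw [finrank_form_one]; omega), hT _ hsub hcard⟩
  · exact hA F (fun p hp => (Finset.mem_insert.1 (hF hp)).resolve_left fun h => hoF (h ▸ hp))
      (by rwa [finrank_form_one])

end Position

/-! ### Spans of Veronese images -/

section Veronese

variable {n : ℕ}

theorem veronese_rep (d : ℕ) (p : Pn n) :
    ∃ g : ℂ, g ≠ 0 ∧ (veronese n d p).rep = g • powForm d p.rep := by
  obtain ⟨g, hg⟩ := Projectivization.exists_smul_eq_mk_rep ℂ (powForm d p.rep)
    (powForm_ne_zero d p.rep_nonzero)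
  exact ⟨g, g.ne_zero, hg.symm⟩

theorem veronese_injective (d : ℕ) (hd : d ≠ 0) : Function.Injective (veronese n d) := by
  intro p p' h
  by_contra hne
  obtain ⟨φ, hp, hp'⟩ := exists_dual_of_ne hne
  obtain ⟨z, hz⟩ := exists_eval_eq_dual φ
  obtain ⟨s, hs⟩ := (Projectivization.mk_eq_mk_iff' ℂ _ _ _ _).1 h
  have h1 := congrArg (fun F : Form n d =>
    MvPolynomial.eval z (F : MvPolynomial (Fin (n + 1)) ℂ)) hs
  simp [powForm, MvPolynomial.smul_eval, hz, hp', hd] at h1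
  exact hp (eq_zero_of_pow_eq_zero h1.symm)

theorem mem_linSpan_veronese_iff (d : ℕ) (A : Finset (Pn n)) (q : ℙ ℂ (Form n d)) :
    q ∈ linSpan (veronese n d '' (A : Set (Pn n))) ↔
      ∃ c : Pn n → ℂ, ∑ p ∈ A, c p • powForm d p.rep = q.rep := by
  rw [mem_linSpan_iff, ← mem_span_image_finset_iff (fun p : Pn n => powForm d p.rep)]
  have : Submodule.span ℂ (Projectivization.rep '' (veronese n d '' (A : Set (Pn n)))) =
      Submodule.span ℂ ((fun p : Pn n => powForm d p.rep) '' (A : Set (Pn n))) := by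
    apply le_antisymm
    · rw [Submodule.span_le]
      rintro _ ⟨_, ⟨p, hp, rfl⟩, rfl⟩
      obtain ⟨g, -, hg⟩ := veronese_rep d p
      rw [hg]
      exact Submodule.smul_mem _ _ (Submodule.subset_span ⟨p, hp, rfl⟩)
    · rw [Submodule.span_le]
      rintro _ ⟨p, hp, rfl⟩
      obtain ⟨g, hg0, hg⟩ := veronese_rep d p
      refine (Submodule.smul_mem_iff _ hg0).1 ?_
      beta_reduce
      rw [← hg]
      exact Submodule.subset_span ⟨_, ⟨p, hp, rfl⟩, rfl⟩
  rw [this]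

theorem MinimallySpans.coeff_ne_zero {d : ℕ} (hd : d ≠ 0) {S : Finset (Pn n)}
    {q : ℙ ℂ (Form n d)} (hq : MinimallySpans (veronese n d '' (S : Set (Pn n))) q)
    {c : Pn n → ℂ} (hc : ∑ p ∈ S, c p • powForm d p.rep = q.rep) : ∀ p ∈ S, c p ≠ 0 := by
  classical
  intro p hp h0
  refine hq.2 (veronese n d '' ((S.erase p : Finset (Pn n)) : Set (Pn n))) ?_ ?_
  · refine (veronese_injective d hd).image_strictMono ?_
    exact_mod_cast Finset.erase_ssubset hp
  · rw [mem_linSpan_veronese_iff]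
    exact ⟨c, by rw [← hc, ← Finset.add_sum_erase S _ hp, h0, zero_smul, zero_add]⟩

theorem exists_image_veronese_eq [DecidableEq (ℙ ℂ (Form n 4))] {B : Finset (ℙ ℂ (Form n 4))}
    (hB : (B : Set (ℙ ℂ (Form n 4))) ⊆ veroneseVariety n 4) :
    ∃ A : Finset (Pn n), A.image (veronese n 4) = B ∧ A.card = B.card := by
  rw [veroneseVariety, ← Set.image_univ] at hB
  obtain ⟨A, -, hA⟩ := Finset.subset_set_image_iff.1 hB
  exact ⟨A, hA, by rw [← hA, Finset.card_image_of_injective _ (veronese_injective 4 (by simp))]⟩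

end Veronese

/-! ### Subspaces containing more points than expected -/

section Subspaces

variable {n : ℕ} {S' : Finset (Pn n)}

/-- Three points of `S'` are independent because `n ≥ 2`, so a line with three points of `insert o
S'` contains `o` and is spanned by two of its points in `S'`. -/
theorem exists_pair_of_ncard [DecidableEq (Pn n)] (hn : 2 ≤ n) (hS : GenPos S') {o : Pn n}
    {N : Projectivization.Subspace ℂ (Form n 1)} (hN : projDim N = 1)
    (hcard : 3 ≤ ((N : Set (Pn n)) ∩ (insert o S' : Finset (Pn n))).ncard) :
    ∃ a ∈ S', ∃ b ∈ S', a ≠ b ∧ o.rep ∈ Submodule.span ℂ {a.rep, b.rep} := by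
  classical
  set M := Projectivization.Subspace.submodule N with hM
  have hrk : finrank ℂ M = 2 := by
    have hN' : (finrank ℂ M : ℤ) - 1 = 1 := hN
    omega
  set G : Finset (Pn n) := (insert o S').filter fun p => p ∈ N with hG
  have hGcard : 3 ≤ G.card := by
    rw [← Set.ncard_coe_finset]
    convert hcard using 2
    ext p
    simp [hG, and_comm]
  have hGM : ∀ p ∈ G, p.rep ∈ M := fun p hp =>
    (mem_subspace_iff_rep N p).1 (Finset.mem_filter.1 hp).2
  have hspan : ∀ F ⊆ G,
      Submodule.span ℂ (Projectivization.rep '' (F : Set (Pn n))) ≤ M := by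
    intro F hF
    rw [Submodule.span_le]
    rintro _ ⟨p, hp, rfl⟩
    exact hGM p (hF hp)
  have hoG : o ∈ G := by
    by_contra hoG
    obtain ⟨F, hF, hFcard⟩ := Finset.exists_subset_card_eq hGcard
    have hFS : F ⊆ S' := fun p hp => (Finset.mem_insert.1 (Finset.mem_filter.1 (hF hp)).1).resolve_left
      fun h => hoG (h ▸ hF hp)
    have h1 := Submodule.finrank_mono (hspan F hF)
    rw [hS.finrank_span_image hFS (by omega)] at h1
    omega
  obtain ⟨F, hF, hFcard⟩ := Finset.exists_subset_card_eq (s := G.erase o) (n := 2)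
    (by rw [Finset.card_erase_of_mem hoG]; omega)
  obtain ⟨a, b, hab, rfl⟩ := Finset.card_eq_two.1 hFcard
  have hmem : ∀ p ∈ ({a, b} : Finset (Pn n)), p ∈ S' := fun p hp => by
    have := hF hp
    rw [Finset.mem_erase] at this
    exact (Finset.mem_insert.1 (Finset.mem_filter.1 this.2).1).resolve_left this.1
  refine ⟨a, hmem a (by simp), b, hmem b (by simp), hab, ?_⟩
  have h1 := hspan {a, b} (hF.trans (Finset.erase_subset _ _))
  rw [Finset.coe_pair, Set.image_pair] at h1
  rw [Submodule.eq_of_le_of_finrank_le h1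
    (by rw [hrk, hS.finrank_span_pair (by rw [finrank_form_one]; omega) (hmem a (by simp))
      (hmem b (by simp)) hab])]
  exact hGM o hoG

/-- A dependency `o ∈ ⟨T⟩` bounds the least dimension of a linear subspace which contains more
points than expected. -/
theorem mem_excess_of_mem_span [DecidableEq (Pn n)] (hS : GenPos S') {o : Pn n} (ho : o ∉ S')
    {T : Finset (Pn n)} (hT : T ⊆ S') (hTn : T.card ≤ n + 1)
    (hoT : o.rep ∈ Submodule.span ℂ (Projectivization.rep '' (T : Set (Pn n)))) :
    T.card - 1 ∈ {m : ℕ | ∃ N : Projectivization.Subspace ℂ (Form n 1),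
      projDim N = m ∧ m + 2 ≤ ((N : Set (Pn n)) ∩ (insert o S' : Finset (Pn n))).ncard} := by
  have hpos : 0 < T.card := by
    rw [Finset.card_pos]
    by_contra h
    rw [Finset.not_nonempty_iff_eq_empty] at h
    rw [h] at hoT
    simp at hoT
    exact o.rep_nonzero hoT
  refine ⟨linSpan (T : Set (Pn n)), ?_, ?_⟩
  · rw [projDim, submodule_linSpan, hS.finrank_span_image hT hTn]
    omega
  · have hsub : ((insert o T : Finset (Pn n)) : Set (Pn n)) ⊆
        (linSpan (T : Set (Pn n)) : Set (Pn n)) ∩ (insert o S' : Finset (Pn n)) := by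
      intro p hp
      rw [Finset.mem_coe, Finset.mem_insert] at hp
      rcases hp with rfl | hp
      · exact ⟨(mem_linSpan_iff _ _).2 hoT, by simp⟩
      · exact ⟨Projectivization.Subspace.subset_span _ hp, by simp [hT hp]⟩
    have h1 := Set.ncard_le_ncard hsub
      ((Finset.finite_toSet (insert o S')).subset Set.inter_subset_right)
    rw [Set.ncard_coe_finset, Finset.card_insert_of_notMem fun h => ho (hT h)] at h1
    omega

end Subspaces

/-! ### Rank, identifiability and dimension of the family -/

section Rank

variable {n : ℕ} {S : Finset (Pn n)} {c : Pn n → ℂ} {q : ℙ ℂ (Form n 4)}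

theorem xRank_eq_card (hc : ∀ p ∈ S, c p ≠ 0)
    (hind : ∀ x : Pn n → ℂ, SqRel S x → ∀ p ∈ S, x p = 0)
    (hq : ∑ p ∈ S, c p • powForm 4 p.rep = q.rep) :
    xRank (veroneseVariety n 4) q = S.card := by
  classical
  refine IsLeast.csInf_eq ⟨⟨S.image (veronese n 4), ?_, ?_, ?_⟩, ?_⟩
  · rw [Finset.coe_image]
    exact Set.image_subset_range _ _
  · rw [Finset.coe_image, mem_linSpan_veronese_iff]
    exact ⟨c, hq⟩
  · exact Finset.card_image_of_injective _ (veronese_injective 4 (by simp))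
  · rintro k ⟨B, hB, hqB, rfl⟩
    obtain ⟨A, rfl, hcard⟩ := exists_image_veronese_eq hB
    rw [Finset.coe_image, mem_linSpan_veronese_iff] at hqB
    obtain ⟨d, hd⟩ := hqB
    rw [← hcard]
    exact ((quarticEq_of_sum_eq (hd.trans hq.symm)).card_le_and_sq hc hind).1

theorem mem_rankDecompositions_iff (A : Finset (Pn n)) :
    A ∈ rankDecompositions q ↔ A.card = xRank (veroneseVariety n 4) q ∧
      ∃ d : Pn n → ℂ, ∑ p ∈ A, d p • powForm 4 p.rep = q.rep := by
  classical
  constructor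
  · rintro ⟨B, ⟨-, hq, hcard⟩, hAB, himg⟩
    rw [← himg, mem_linSpan_veronese_iff] at hq
    exact ⟨hAB.trans hcard, hq⟩
  · rintro ⟨hcard, hd⟩
    have hinj := Finset.card_image_of_injective A (veronese_injective (n := n) 4 (by simp))
    refine ⟨A.image (veronese n 4), ⟨?_, ?_, hinj.trans hcard⟩, hinj.symm, by rw [Finset.coe_image]⟩
    · rw [Finset.coe_image]
      exact Set.image_subset_range _ _
    · rw [Finset.coe_image, mem_linSpan_veronese_iff]
      exact hd

theorem identifiable_iff_subsingleton (hS : S ∈ rankDecompositions q) :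
    Identifiable (veroneseVariety n 4) q ↔ ∀ A ∈ rankDecompositions q, A = S := by
  classical
  have himg : ∀ {A : Finset (Pn n)} {B : Finset (ℙ ℂ (Form n 4))},
      veronese n 4 '' (A : Set (Pn n)) = (B : Set (ℙ ℂ (Form n 4))) →
      B = A.image (veronese n 4) := by
    intro A B h
    rw [← Finset.coe_inj, ← h, Finset.coe_image]
  obtain ⟨B₀, hB₀, -, hB₀S⟩ := hS
  constructor
  · rintro ⟨B₁, -, huniq⟩ A ⟨B, hB, -, hBA⟩
    have h1 : A.image (veronese n 4) = S.image (veronese n 4) := by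
      rw [← himg hBA, ← himg hB₀S, huniq B hB, huniq B₀ hB₀]
    exact Finset.image_injective (veronese_injective 4 (by simp)) h1
  · intro h
    refine ⟨B₀, hB₀, fun B hB => ?_⟩
    obtain ⟨A, rfl, hcard⟩ := exists_image_veronese_eq hB.1
    rw [h A ⟨_, hB, hcard, by rw [Finset.coe_image]⟩, himg hB₀S]

/-- The pencils attached to the `B i` contain all Chow forms of minimal decompositions, and the line
`L₀` provides infinitely many of them. Infinitude also yields a decomposition other than `S`. -/
theorem evincingDim_eq_one_of_threeOn {k : ℕ} (hrank : xRank (veroneseVariety n 4) q = k)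
    (hq : ∑ p ∈ S, c p • powForm 4 p.rep = q.rep) {ι : Type*} [Finite ι]
    {L : ι → Submodule ℂ (Form n 1)} {B : ι → Finset (Pn n)} {f : ι → Pn n → ℂ}
    (hthree : ∀ i, ThreeOn (L i) (B i) (f i)) (hBcard : ∀ i, (B i).card = k)
    (hBeq : ∀ i, QuarticEq (B i) (f i) S c)
    (hcov : ∀ (A : Finset (Pn n)) (d : Pn n → ℂ), A.card = k → QuarticEq A d S c →
      ∃ i, ptsOff (L i) A = ptsOff (L i) (B i)) {L₀ : Submodule ℂ (Form n 1)}
    (hS : ThreeOn L₀ S c) (hScard : S.card = k) :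
    evincingDim q = 1 ∧ ∃ A ∈ rankDecompositions q, A ≠ S := by
  have hinf := hS.infinite_chowPoint k hScard
  constructor
  · unfold evincingDim familyDim
    rw [hrank]
    choose W hfd hrk hW using fun i => (hthree i).exists_pencil k (hBcard i)
    refine zariskiDim_eq_one (hinf.mono ?_) W hfd hrk ?_
    · rintro P ⟨A, hA, d, hd, rfl⟩
      exact ⟨A, hA, (mem_rankDecompositions_iff A).2 ⟨hA.trans hrank.symm, d, hd.trans hq⟩, rfl⟩
    · rintro P ⟨A, hA, hAq, rfl⟩
      obtain ⟨-, d, hd⟩ := (mem_rankDecompositions_iff A).1 hAq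
      have hAS := quarticEq_of_sum_eq (hd.trans hq.symm)
      obtain ⟨i, hi⟩ := hcov A d hA hAS
      have hmem := hW i A d hA (fun φ₁ φ₂ φ₃ φ₄ =>
        (hAS φ₁ φ₂ φ₃ φ₄).trans (hBeq i φ₁ φ₂ φ₃ φ₄).symm) hi
      obtain ⟨g, hg⟩ := Projectivization.exists_smul_eq_mk_rep ℂ (prodForm A hA)
        (prodForm_ne_zero A hA)
      refine ⟨i, ?_⟩
      rw [chowPoint, ← hg]
      exact (W i).smul_mem (g : ℂ) hmem
  · obtain ⟨P, ⟨A, hA, d, hd, rfl⟩, hne⟩ := hinf.exists_notMem_finite (t := {chowPoint S hScard})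
      (Set.finite_singleton _)
    refine ⟨A, (mem_rankDecompositions_iff A).2 ⟨hA.trans hrank.symm, d, hd.trans hq⟩, ?_⟩
    rintro rfl
    exact hne rfl

end Rank

end Waring

/-! ### The main theorem -/

open Waring Module

theorem theorem3p1 (n : ℕ) (S : Finset (Pn n)) (hS : S.card = 2 * n + 1)
    (q : ℙ ℂ (Form n 4))
    (hq : MinimallySpans (veronese n 4 '' (S : Set (Pn n))) q)
    (S' : Finset (Pn n)) (hS'S : S' ⊆ S) (hS' : S'.card = 2 * n) (hLGP : LGP S')
    (hmax : ∀ S'' : Finset (Pn n), S' ⊂ S'' → S'' ⊆ S → ¬ LGP S'')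
    (e : ℕ)
    (he : IsLeast {m : ℕ | ∃ N : Projectivization.Subspace ℂ (Form n 1),
      projDim N = m ∧ m + 2 ≤ ((N : Set (Pn n)) ∩ (S : Set (Pn n))).ncard} e) :
    xRank (veroneseVariety n 4) q = 2 * n + 1 ∧
    (Identifiable (veroneseVariety n 4) q ↔ 2 ≤ e) ∧
    (e = 1 → evincingDim q = 1) := by
  classical
  have hV : finrank ℂ (Form n 1) = n + 1 := finrank_form_one
  have hgen := genPos_of_LGP hLGP
  obtain ⟨o, hoS, rfl⟩ : ∃ o ∉ S', insert o S' = S := by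
    obtain ⟨o, ho⟩ := Finset.card_eq_one.1 (show (S \ S').card = 1 by
      rw [Finset.card_sdiff_of_subset hS'S]; omega)
    have ho' : o ∈ S \ S' := ho ▸ Finset.mem_singleton_self o
    refine ⟨o, (Finset.mem_sdiff.1 ho').2, ?_⟩
    rw [Finset.insert_eq, ← ho, Finset.sdiff_union_of_subset hS'S]
  -- Maximality of `S'` is applied to the whole of `S`.
  obtain ⟨T, hT, hTn, hoT⟩ := exists_mem_span_of_not_LGP hgen
    (hmax _ (Finset.ssubset_insert hoS) subset_rfl)
  obtain ⟨c, hc⟩ := (mem_linSpan_veronese_iff 4 _ q).1 hq.1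
  have hc0 := hq.coeff_ne_zero (by simp) hc
  have hTe := he.2 (mem_excess_of_mem_span hgen hoS hT (by omega) hoT)
  have he0 : e ≠ 0 := by
    rintro rfl
    obtain ⟨N, hN, hcard⟩ := he.1
    have := ncard_lt_two_of_projDim_eq_zero (by exact_mod_cast hN) (insert o S')
    omega
  -- From `1 ≤ e ≤ T.card - 1 ≤ n - 1`. The same bound gives `3 ≤ n` once `e ≥ 2`.
  have hn : 2 ≤ n := by omega
  have hind := fun x hx => SqRel.eq_zero (c := x) hV (by omega) hgen hS' hoS hx
  have hrank : xRank (veroneseVariety n 4) q = 2 * n + 1 := (xRank_eq_card hc0 hind hc).trans hS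
  have hSmem : insert o S' ∈ rankDecompositions q :=
    (mem_rankDecompositions_iff _).2 ⟨hS.trans hrank.symm, c, hc⟩
  have hone : e = 1 → evincingDim q = 1 ∧ ∃ A ∈ rankDecompositions q, A ≠ insert o S' := by
    rintro rfl
    obtain ⟨N, hN, hcard⟩ := he.1
    obtain ⟨a, ha, b, hb, hab, ho⟩ := exists_pair_of_ncard hn hgen (by exact_mod_cast hN) hcard
    obtain ⟨L, B, f, h1, h2, h3, h4⟩ := exists_threeOn hV hn hgen hS' hoS ha hb hab ho hc0
    exact evincingDim_eq_one_of_threeOn hrank hc h1 h2 h3 h4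
      (threeOn_insert hV hn hgen hS' hoS ha hb hab ho hc0) hS
  refine ⟨hrank, ?_, fun h => (hone h).1⟩
  rw [identifiable_iff_subsingleton hSmem]
  constructor
  · intro h
    by_contra hlt
    obtain ⟨A, hA, hne⟩ := (hone (by omega)).2
    exact hne (h A hA)
  · intro h2 A hA
    obtain ⟨hAcard, d, hd⟩ := (mem_rankDecompositions_iff A).1 hA
    have hAS := quarticEq_of_sum_eq (hd.trans hc.symm)
    have hcard : A.card = (insert o S').card := by rw [hAcard, hrank, hS]
    -- `T` is enlarged to exactly half of `S'`, as `SqRel.coordinates` requires.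
    obtain ⟨T', hTT', hT'S, hT'⟩ := Finset.exists_subsuperset_card_eq hT hTn (by omega)
    obtain ⟨a, ha⟩ := (mem_span_image_finset_iff _ T' _).1
      (Submodule.span_mono (Set.image_mono (Finset.coe_subset.2 hTT')) hoT)
    refine hAS.eq_of_not_collinear hV (by omega) hgen hS' hT'S hT' hoS ha ?_ hcard hc0
      (hAS.coeff_ne_zero hc0 hind hcard.le)
    intro s hs t ht hst hos
    -- A line through `s`, `t` and `o` would have three points of `S`, forcing `e ≤ 1`.
    have := he.2 (mem_excess_of_mem_span hgen hoS (T := {s, t})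
      (by simp [Finset.insert_subset_iff, hs, ht]) (by rw [Finset.card_pair hst]; omega)
      (by rwa [Finset.coe_pair, Set.image_pair]))
    rw [Finset.card_pair hst] at this
    omega
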